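/- Let $N=2$ or $N=3$, write points of $\mathbb{R}^N$ as $(x',x_N)$ with $x'\in\mathbb{R}^{N-1}$, and let $\mathbb{R}^N_+=\mathbb{R}^{N-1}\times(0,+\infty)$. Let $$A(x')=\begin{pmatrix}\widehat A(x') & 0\\ 0 & 1\end{pmatrix},$$ where $\widehat A(x')$ is a real symmetric $(N-1)\times(N-1)$ matrix whose entries $a_{ij}$ belong to $C^1(\mathbb{R}^{N-1})\cap L^\infty(\mathbb{R}^{N-1})$ and which satisfies $\sum_{i,j=1}^{N-1} a_{ij}(x')\xi_i\xi_j>0$ for all $x'\in\mathbb{R}^{N-1}$ and $\xi\in\mathbb{R}^{N-1}\setminus\{0\}$. Let $g:\mathbb{R}\to\mathbb{R}$ be continuous and $2\pi$-periodic, with Fourier coefficients $$c_m=\frac1\pi\int_0^{2\pi}g(t)\cos(mt)\,dt\quad(m\ge0),\qquad d_m=\frac1\pi\int_0^{2\pi}g(t)\sin(mt)\,dt\quad(m\ge1),$$ and assume that $c_1\ge0$ and $d_1\ge0$. Suppose that there is a function $u\in C^2(\overline{\mathbb{R}^N_+})$ that solves $$-\operatorname{div}\big(A(x')\nabla u\big)=u-g(x_N)\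 \text{ in }\mathbb{R}^N_+,\qquad u=0\ \text{ on }\partial\mathbb{R}^N_+,\tag{P}$$ and is nonnegative and bounded on strips, that is: for every $M>0$ there is $C(M)>0$ such that $0\le u(x)\le C(M)$ for all $x\in\mathbb{R}^{N-1}\times[0,M]$. Then $c_1=d_1=0$. Moreover $u$ is the only solution of (P) in this class; it is one-dimensional, i.e. there is $w:[0,+\infty)\to\mathbb{R}$ with $u(x',x_N)=w(x_N)$ for all $x'\in\mathbb{R}^{N-1}$ and $x_N\ge0$; it is $2\pi$-periodic, i.e. $w(t+2\pi)=w(t)$ for all $t\ge0$; and $w$ is the unique function in $C^2([0,+\infty))$ such that $$\begin{cases}-w''(t)=w(t)-g(t) & \text{for } t\in(0,+\infty),\\ w(0)=w(2\pi)=0,\\ w'(0)=w'(2\pi)=0,\end{cases}$$ where $w'(0)$ is the one-sided derivative. Finally, for all $t\ge0$, $$w(t)=\frac{c_0}{2}+\Big(-\frac{c_0}{2}+\sum_{m=2}^{\infty}\frac{c_m}{m^2-1}\Big)\cos t+\Big(\sum_{m=2}^{\infty}\frac{m}{m^2-1}d_m\Big)\sin t-\sum_{m=2}^{\infty}\Big(\frac{c_m}{m^2-1}\cos(mt)+\frac{d_m}{m^2-1}\sin(mt)\Big),$$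 where all the series converge absolutely. -/

import Mathlib

open Set Real

/-- Points `(x', x_N)` of `ℝ^{n+1} = ℝ^n × ℝ`, where `n = N - 1`; the last coordinate is `x.2`. -/
abbrev Pt (n : ℕ) : Type := EuclideanSpace ℝ (Fin n) × ℝ

/-- The open half space `ℝ^n × (0, ∞)`. -/
def openHalfSpace (n : ℕ) : Set (Pt n) := {x | 0 < x.2}

/-- The closed half space `ℝ^n × [0, ∞)`. -/
def closedHalfSpace (n : ℕ) : Set (Pt n) := {x | 0 ≤ x.2}

/-- The canonical basis of `ℝ^n × ℝ`: the coordinates of `x'` are indexed by `Sum.inl i`, the last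
coordinate by `Sum.inr ()`. -/
noncomputable def basisVec {n : ℕ} : Fin n ⊕ Unit → Pt n
  | Sum.inl i => (EuclideanSpace.single i (1 : ℝ), 0)
  | Sum.inr _ => (0, 1)

/-- The partial derivative of `f` in the `i`-th coordinate. -/
noncomputable def pderiv {n : ℕ} (i : Fin n ⊕ Unit) (f : Pt n → ℝ) (x : Pt n) : ℝ :=
  fderiv ℝ f x (basisVec i)

/-- `div (A ∇u) = ∑ᵢ ∂ᵢ (∑ⱼ aᵢⱼ ∂ⱼ u)`. -/
noncomputable def divGrad {n : ℕ} (A : Pt n → Matrix (Fin n ⊕ Unit) (Fin n ⊕ Unit) ℝ)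
    (u : Pt n → ℝ) (x : Pt n) : ℝ :=
  ∑ i, pderiv i (fun y => ∑ j, A y i j * pderiv j u y) x

/-- The block matrix `A(x') = [[Â(x'), 0], [0, 1]]`. -/
def blockMatrix {n : ℕ} (Ahat : EuclideanSpace ℝ (Fin n) → Matrix (Fin n) (Fin n) ℝ) (x : Pt n) :
    Matrix (Fin n ⊕ Unit) (Fin n ⊕ Unit) ℝ :=
  Matrix.fromBlocks (Ahat x.1) 0 0 1

/-- `Â` is symmetric and (pointwise) positive definite, with bounded entries of class `C¹`. -/
structure AdmissibleCoeff {n : ℕ}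
    (Ahat : EuclideanSpace ℝ (Fin n) → Matrix (Fin n) (Fin n) ℝ) : Prop where
  symm : ∀ x i j, Ahat x i j = Ahat x j i
  contDiff : ∀ i j, ContDiff ℝ 1 (fun x => Ahat x i j)
  bounded : ∀ i j, ∃ C : ℝ, ∀ x, |Ahat x i j| ≤ C
  pos : ∀ x, ∀ ξ : Fin n → ℝ, ξ ≠ 0 → 0 < ∑ i, ∑ j, Ahat x i j * ξ i * ξ j

/-- `u`, of class `C²` up to the boundary of the half space, solves
`-div (A ∇u) = u - g(x_N)` in the open half space and `u = 0` on its boundary. -/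
structure IsClassicalSolution {n : ℕ}
    (A : Pt n → Matrix (Fin n ⊕ Unit) (Fin n ⊕ Unit) ℝ) (g : ℝ → ℝ) (u : Pt n → ℝ) : Prop where
  contDiffOn : ContDiffOn ℝ 2 u (closedHalfSpace n)
  eqn : ∀ x ∈ openHalfSpace n, -divGrad A u x = u x - g x.2
  boundary : ∀ x' : EuclideanSpace ℝ (Fin n), u (x', 0) = 0

/-- `u` is nonnegative on the closed half space and bounded on every strip `ℝ^n × [0, M]`. -/
def NonnegBoundedOnStrips {n : ℕ} (u : Pt n → ℝ) : Prop :=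
  ∀ M : ℝ, 0 < M → ∃ C : ℝ, 0 < C ∧
    ∀ (x' : EuclideanSpace ℝ (Fin n)), ∀ t ∈ Icc 0 M, 0 ≤ u (x', t) ∧ u (x', t) ≤ C

/-- `c_m = (1/π) ∫₀^{2π} g(t) cos(mt) dt`. -/
noncomputable def cosCoeff (g : ℝ → ℝ) (m : ℕ) : ℝ :=
  1 / π * ∫ t in (0 : ℝ)..(2 * π), g t * cos (m * t)

/-- `d_m = (1/π) ∫₀^{2π} g(t) sin(mt) dt`. -/
noncomputable def sinCoeff (g : ℝ → ℝ) (m : ℕ) : ℝ :=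
  1 / π * ∫ t in (0 : ℝ)..(2 * π), g t * sin (m * t)

/-- `w`, of class `C²` on `[0, ∞)`, solves `-w'' = w - g` in `(0, ∞)` together with
`w(0) = w(2π) = 0` and `w'(0) = w'(2π) = 0` (the derivative at `0` is one-sided). -/
structure IsODESolution (g w : ℝ → ℝ) : Prop where
  contDiffOn : ContDiffOn ℝ 2 w (Ici 0)
  eqn : ∀ t, 0 < t → -deriv (deriv w) t = w t - g t
  zero_left : w 0 = 0
  zero_right : w (2 * π) = 0
  deriv_left : derivWithin w (Ici 0) 0 = 0
  deriv_right : derivWithin w (Ici 0) (2 * π) = 0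

/-!
The operator `div (A ∇u)` splits as `L u + ∂_N² u`, where `L = div' (Â ∇')` acts on `x'` alone. On
a strip `a ≤ x_N ≤ a + 2π`, with `a` a multiple of `2π` and `u = 0` at height `a`, integrate the
equation against `φ (x_N)`, where `φ` is `sin (k ·)` or `cos (k ·)`. By Green's formula in `x_N`,
the bounded function `U(x') = ∫ u(x', t) φ(t) dt` satisfies `L U = (k² - 1) U + ∫ g φ + boundary
terms` (`tangentialDivGrad_stripIntegral_of_isClassicalSolution`).

Since `x'` ranges over a space of dimension at most two, there are cutoff functions of arbitrarily
small Dirichlet energy (`exists_cutoff_integral_sq_norm_fderiv_le`). With Caccioppoli's inequality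
they give a Liouville theorem: a bounded `T` with `T * L T ≥ 0` is constant
(`eq_of_bounded_of_mul_tangentialDivGrad_nonneg`). No uniform ellipticity is needed, only the
boundedness of the coefficients.

For `k = 1` and `φ = sin`, one has `L U = u(x', a + 2π) + π d₁ ≥ 0`, so that `U` is constant, `d₁
= 0` and `u = 0` at height `a + 2π`; as `u ≥ 0`, its normal derivative vanishes there too. For `k
= 1` and `φ = cos`, then `L U = ∂_N u(x', a) + π c₁ ≥ 0`, hence `U` is constant, `c₁ = 0` and `∂_N
u = 0` at height `a`. Now all boundary terms vanish, and for `k ≥ 2` the equation `L U = (k² - 1)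
U + ∫ g φ` forces `U` to be constant. Therefore `u(x', ·) - u(y', ·)` has no nonzero Fourier
coefficient of positive frequency on the strip; it is constant in `x_N`, thus zero
(`strip_symmetry`). Induction over the strips shows that `u(x', t) = w(t)` with `w` a solution of
the one-dimensional problem (`isODESolution_of_isClassicalSolution`).

Uniqueness and periodicity of `w` are uniqueness for `z'' = -z` with zero Cauchy data. The
equation gives the Fourier coefficients of `w` of order `m ≠ 1` from those of `g`, dividing by `1
- m²`; the two coefficients of order one are determined by `w(0) = 0` and, differentiating the
series termwise, by `w'(0) = 0`. Bessel's inequality for `g` provides all the summability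
(`IsODESolution.hasFourierExpansion`).
-/

/-! ### Cutoff functions of small energy in dimension at most two -/

open MeasureTheory Metric Module in
/-- Dilates `χ (x / (r 4^j))` of a bump function. In dimension at most two the Dirichlet energy does
not increase under dilation by a factor at least one, and the gradient of the `j`-th dilate lives
in the annulus `r 4^j ≤ ‖x‖ ≤ 2 r 4^j`; these annuli are disjoint. -/
theorem exists_dilates_disjoint_fderiv {E : Type*} [NormedAddCommGroup E]
    [InnerProductSpace ℝ E] [FiniteDimensional ℝ E] [MeasurableSpace E] [BorelSpace E]
    (hE : finrank ℝ E ≤ 2) {r : ℝ} (hr : 1 ≤ r) :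
    ∃ (c : ℕ → E → ℝ) (K : ℝ), (∀ j, ContDiff ℝ 1 (c j)) ∧ (∀ j, HasCompactSupport (c j)) ∧
      (∀ j x, ‖x‖ ≤ r → c j x = 1) ∧ (∀ j, ∫ x, ‖fderiv ℝ (c j) x‖ ^ 2 ≤ K) ∧ 0 ≤ K ∧
      ∀ i j x, i ≠ j → ‖fderiv ℝ (c i) x‖ * ‖fderiv ℝ (c j) x‖ = 0 := by
  let χ : ContDiffBump (0 : E) := ⟨1, 2, one_pos, one_lt_two⟩
  have hχ : ContDiff ℝ 1 χ := χ.contDiff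
  have hDχ : Continuous (fun x => ‖fderiv ℝ χ x‖ ^ 2) :=
    (hχ.continuous_fderiv one_ne_zero).norm.pow 2
  have hDχc : HasCompactSupport (fun x => ‖fderiv ℝ χ x‖ ^ 2) :=
    (χ.hasCompactSupport.fderiv ℝ).comp_left (g := fun L => ‖L‖ ^ 2) (by simp)
  have hDχ0 : ∀ x, fderiv ℝ χ x ≠ 0 → 1 ≤ ‖x‖ ∧ ‖x‖ ≤ 2 := by
    intro x hx
    constructor
    · by_contra! h
      refine hx ?_
      rw [(χ.eventuallyEq_one_of_mem_ball (by simpa [χ] using h)).fderiv_eq]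
      exact fderiv_const_apply (1 : ℝ)
    · by_contra! h
      refine hx (fderiv_of_notMem_tsupport ℝ ?_)
      rw [χ.tsupport_eq]
      simpa [χ] using h
  set K := ∫ x, ‖fderiv ℝ χ x‖ ^ 2 with hK
  have hK0 : 0 ≤ K := integral_nonneg fun x => by positivity
  obtain ⟨R, hR⟩ : ∃ R : ℕ → ℝ, ∀ j, R j = r * 4 ^ j := ⟨_, fun _ => rfl⟩
  have hR1 : ∀ j, 1 ≤ R j := fun j => by
    have : (1 : ℝ) ≤ 4 ^ j := one_le_pow₀ (by norm_num)
    rw [hR]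
    nlinarith
  have hR0 : ∀ j, 0 < R j := fun j => lt_of_lt_of_le one_pos (hR1 j)
  have hRmono : ∀ i j, i ≤ j → R i ≤ R j := fun i j hij => by
    rw [hR, hR]
    exact mul_le_mul_of_nonneg_left (pow_le_pow_right₀ (by norm_num) hij) (by linarith)
  let c : ℕ → E → ℝ := fun j x => χ ((R j)⁻¹ • x)
  have hc : ∀ j, ContDiff ℝ 1 (c j) := fun j => hχ.comp (contDiff_const_smul _)
  have hDc : ∀ j x, fderiv ℝ (c j) x = (R j)⁻¹ • fderiv ℝ χ ((R j)⁻¹ • x) := fun j x =>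
    fderiv_comp_smul _
  have hcc : ∀ j, HasCompactSupport (c j) := fun j =>
    χ.hasCompactSupport.comp_homeomorph (Homeomorph.smulOfNeZero _ (inv_ne_zero (hR0 j).ne'))
  have hsupp : ∀ j x, fderiv ℝ (c j) x ≠ 0 → R j ≤ ‖x‖ ∧ ‖x‖ ≤ 2 * R j := by
    intro j x hx
    rw [hDc] at hx
    have h := hDχ0 _ (right_ne_zero_of_smul hx)
    rw [norm_smul, norm_inv, Real.norm_of_nonneg (hR0 j).le, ← div_eq_inv_mul,
      le_div_iff₀ (hR0 j), div_le_iff₀ (hR0 j), one_mul] at h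
    exact h
  have henergy : ∀ j, ∫ x, ‖fderiv ℝ (c j) x‖ ^ 2 ≤ K := by
    intro j
    have h1 : ∀ x, ‖fderiv ℝ (c j) x‖ ^ 2 =
        (R j)⁻¹ ^ 2 * ‖fderiv ℝ χ ((R j)⁻¹ • x)‖ ^ 2 := fun x => by
      rw [hDc, norm_smul, norm_inv, Real.norm_of_nonneg (hR0 j).le, mul_pow]
    simp_rw [h1]
    rw [integral_const_mul, Measure.integral_comp_inv_smul_of_nonneg _
      (fun x => ‖fderiv ℝ χ x‖ ^ 2) (hR0 j).le, ← hK, smul_eq_mul, ← mul_assoc]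
    refine mul_le_of_le_one_left hK0 ?_
    rw [inv_pow, inv_mul_le_iff₀ (by have := hR0 j; positivity), mul_one]
    exact pow_le_pow_right₀ (hR1 j) hE
  -- the gradients of distinct dilates have disjoint supports
  have hdisj : ∀ i j x, i ≠ j → ‖fderiv ℝ (c i) x‖ * ‖fderiv ℝ (c j) x‖ = 0 := by
    have key : ∀ i j x, i < j → ‖fderiv ℝ (c i) x‖ * ‖fderiv ℝ (c j) x‖ = 0 := by
      intro i j x hij
      by_contra h
      have h1 := (hsupp i x (norm_ne_zero_iff.1 (left_ne_zero_of_mul h))).2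
      have h2 := (hsupp j x (norm_ne_zero_iff.1 (right_ne_zero_of_mul h))).1
      have h3 : R (i + 1) ≤ R j := hRmono _ _ hij
      have h4 : R (i + 1) = 4 * R i := by rw [hR, hR]; ring
      linarith [hR0 i]
    intro i j x hij
    rcases hij.lt_or_gt with h | h
    · exact key i j x h
    · rw [mul_comm]; exact key j i x h
  refine ⟨c, K, hc, hcc, fun j x hx => χ.one_of_mem_closedBall ?_, henergy, hK0, hdisj⟩
  have : r ≤ R j := by
    rw [hR]
    exact le_mul_of_one_le_right (by linarith) (one_le_pow₀ (by norm_num))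
  rw [mem_closedBall, dist_zero_right, norm_smul, norm_inv,
    Real.norm_of_nonneg (hR0 j).le, ← div_eq_inv_mul, div_le_iff₀ (hR0 j)]
  simp only [χ]
  linarith

open MeasureTheory Metric Module in
/-- Spaces of dimension at most two are parabolic: the average of `N` dilates with disjoint
gradients has Dirichlet energy `O(1 / N)`. -/
theorem exists_cutoff_integral_sq_norm_fderiv_le {E : Type*} [NormedAddCommGroup E]
    [InnerProductSpace ℝ E] [FiniteDimensional ℝ E] [MeasurableSpace E] [BorelSpace E]
    (hE : finrank ℝ E ≤ 2) {r ε : ℝ} (hr : 1 ≤ r) (hε : 0 < ε) :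
    ∃ ζ : E → ℝ, ContDiff ℝ 1 ζ ∧ HasCompactSupport ζ ∧ (∀ x, ‖x‖ ≤ r → ζ x = 1) ∧
      ∫ x, ‖fderiv ℝ ζ x‖ ^ 2 ≤ ε := by
  obtain ⟨c, K, hc, hcc, hc1, henergy, hK0, hdisj⟩ :=
    exists_dilates_disjoint_fderiv hE hr
  have hint : ∀ j, Integrable (fun x => ‖fderiv ℝ (c j) x‖ ^ 2) := by
    intro j
    have h1 : Continuous (fun x => ‖fderiv ℝ (c j) x‖ ^ 2) :=
      ((hc j).continuous_fderiv one_ne_zero).norm.pow 2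
    have h2 : HasCompactSupport (fun x => ‖fderiv ℝ (c j) x‖) := ((hcc j).fderiv ℝ).norm
    have h3 : HasCompactSupport (fun x => ‖fderiv ℝ (c j) x‖ ^ 2) :=
      h2.comp_left (g := fun s : ℝ => s ^ 2) (by simp)
    exact h1.integrable_of_hasCompactSupport h3
  obtain ⟨N, hN⟩ := exists_nat_gt (K / ε)
  have hN0 : (0 : ℝ) < N := lt_of_le_of_lt (by positivity) hN
  refine ⟨fun x => (N : ℝ)⁻¹ * ∑ j ∈ Finset.range N, c j x, ?_, ?_, ?_, ?_⟩
  · exact contDiff_const.mul (ContDiff.sum fun j _ => hc j)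
  · have : HasCompactSupport (∑ j ∈ Finset.range N, c j) := by
      refine Finset.sum_induction _ HasCompactSupport (fun _ _ => HasCompactSupport.add)
        HasCompactSupport.zero fun j _ => hcc j
    rw [show (fun x => (N : ℝ)⁻¹ * ∑ j ∈ Finset.range N, c j x) =
      (fun _ => (N : ℝ)⁻¹) * ∑ j ∈ Finset.range N, c j by ext x; simp]
    exact this.mul_left
  · intro x hx
    simp only [hc1 _ x hx]
    simp [hN0.ne']
  · have hD : ∀ x, ‖fderiv ℝ (fun x => (N : ℝ)⁻¹ * ∑ j ∈ Finset.range N, c j x) x‖ ^ 2 ≤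
        (N : ℝ)⁻¹ ^ 2 * ∑ j ∈ Finset.range N, ‖fderiv ℝ (c j) x‖ ^ 2 := by
      intro x
      have hd : ∀ j, DifferentiableAt ℝ (c j) x := fun j =>
        (hc j).differentiable one_ne_zero x
      rw [fderiv_const_mul (DifferentiableAt.fun_sum fun j _ => hd j),
        fderiv_fun_sum fun j _ => hd j, norm_smul, norm_inv, Real.norm_of_nonneg hN0.le, mul_pow]
      refine mul_le_mul_of_nonneg_left ?_ (by positivity)
      calc ‖∑ j ∈ Finset.range N, fderiv ℝ (c j) x‖ ^ 2
          ≤ (∑ j ∈ Finset.range N, ‖fderiv ℝ (c j) x‖) ^ 2 := by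
            gcongr; exact norm_sum_le _ _
        _ = ∑ j ∈ Finset.range N, ‖fderiv ℝ (c j) x‖ ^ 2 := by
            rw [sq, Finset.sum_mul_sum]
            refine Finset.sum_congr rfl fun i hi => ?_
            rw [Finset.sum_eq_single_of_mem i hi fun j _ hji => hdisj i j x hji.symm, sq]
    calc ∫ x, ‖fderiv ℝ (fun x => (N : ℝ)⁻¹ * ∑ j ∈ Finset.range N, c j x) x‖ ^ 2
        ≤ ∫ x, (N : ℝ)⁻¹ ^ 2 * ∑ j ∈ Finset.range N, ‖fderiv ℝ (c j) x‖ ^ 2 :=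
          integral_mono_of_nonneg (Filter.Eventually.of_forall fun x => by positivity)
            ((integrable_finsetSum _ fun j _ => hint j).const_mul _)
            (Filter.Eventually.of_forall hD)
      _ = (N : ℝ)⁻¹ ^ 2 * ∑ j ∈ Finset.range N, ∫ x, ‖fderiv ℝ (c j) x‖ ^ 2 := by
          rw [integral_const_mul, integral_finsetSum _ fun j _ => hint j]
      _ ≤ (N : ℝ)⁻¹ ^ 2 * ∑ j ∈ Finset.range N, K := by
          gcongr with j; exact henergy j
      _ = K / N := by
          rw [Finset.sum_const, Finset.card_range, nsmul_eq_mul]; field_simp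
      _ ≤ ε := by
          rw [div_lt_iff₀ hε] at hN
          rw [div_le_iff₀ hN0]; linarith

/-! ### A Liouville theorem for bounded solutions -/

/-- The operator `L T = div' (B ∇' T) = ∑ᵢ ∂ᵢ (∑ⱼ Bᵢⱼ ∂ⱼ T)` on functions of the tangential
variable `x'`. -/
noncomputable def tangentialDivGrad {n : ℕ}
    (B : EuclideanSpace ℝ (Fin n) → Matrix (Fin n) (Fin n) ℝ)
    (T : EuclideanSpace ℝ (Fin n) → ℝ) (x : EuclideanSpace ℝ (Fin n)) : ℝ :=
  ∑ i, fderiv ℝ (fun y => ∑ j, B y i j * fderiv ℝ T y (EuclideanSpace.single j 1)) x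
    (EuclideanSpace.single i 1)

theorem AdmissibleCoeff.nonneg {n : ℕ}
    {B : EuclideanSpace ℝ (Fin n) → Matrix (Fin n) (Fin n) ℝ} (hB : AdmissibleCoeff B)
    (x : EuclideanSpace ℝ (Fin n)) (v : Fin n → ℝ) : 0 ≤ ∑ i, ∑ j, B x i j * v i * v j := by
  by_cases hv : v = 0
  · simp [hv]
  · exact (hB.pos x v hv).le

/-- The quadratic form of `B x` at `a v + b w` is nonnegative, in expanded form. -/
theorem AdmissibleCoeff.quadraticForm_add_nonneg {n : ℕ}
    {B : EuclideanSpace ℝ (Fin n) → Matrix (Fin n) (Fin n) ℝ} (hB : AdmissibleCoeff B)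
    (x : EuclideanSpace ℝ (Fin n)) (v w : Fin n → ℝ) (a b : ℝ) :
    0 ≤ a ^ 2 * (∑ i, ∑ j, B x i j * v i * v j) + 2 * (a * b * ∑ i, ∑ j, B x i j * w i * v j) +
      b ^ 2 * ∑ i, ∑ j, B x i j * w i * w j := by
  have hsymm : ∑ i, ∑ j, B x i j * v i * w j = ∑ i, ∑ j, B x i j * w i * v j := by
    rw [Finset.sum_comm]
    refine Finset.sum_congr rfl fun i _ => Finset.sum_congr rfl fun j _ => ?_
    rw [hB.symm x j i]; ring
  have h := hB.nonneg x (fun i => a * v i + b * w i)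
  have e : ∑ i, ∑ j, B x i j * (a * v i + b * w i) * (a * v j + b * w j) =
      a ^ 2 * (∑ i, ∑ j, B x i j * v i * v j) + a * b * (∑ i, ∑ j, B x i j * v i * w j) +
      a * b * (∑ i, ∑ j, B x i j * w i * v j) + b ^ 2 * ∑ i, ∑ j, B x i j * w i * w j := by
    simp only [Finset.mul_sum, ← Finset.sum_add_distrib]
    refine Finset.sum_congr rfl fun i _ => Finset.sum_congr rfl fun j _ => ?_
    ring
  rw [e, hsymm] at h
  linarith

theorem AdmissibleCoeff.exists_bound {n : ℕ}
    {B : EuclideanSpace ℝ (Fin n) → Matrix (Fin n) (Fin n) ℝ} (hB : AdmissibleCoeff B) :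
    ∃ Λ : ℝ, 0 ≤ Λ ∧ ∀ (x : EuclideanSpace ℝ (Fin n)) (L : EuclideanSpace ℝ (Fin n) →L[ℝ] ℝ),
      ∑ i, ∑ j, B x i j * L (EuclideanSpace.single i 1) * L (EuclideanSpace.single j 1) ≤
        Λ * ‖L‖ ^ 2 := by
  choose C hC using hB.bounded
  have hC0 : ∀ i j, 0 ≤ C i j := fun i j => (abs_nonneg _).trans (hC i j 0)
  refine ⟨∑ i, ∑ j, C i j, Finset.sum_nonneg fun i _ => Finset.sum_nonneg fun j _ => hC0 i j,
    fun x L => ?_⟩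
  have hL : ∀ i, |L (EuclideanSpace.single i 1)| ≤ ‖L‖ := fun i => by
    simpa using L.le_opNorm (EuclideanSpace.single i 1)
  simp only [Finset.sum_mul]
  refine Finset.sum_le_sum fun i _ => Finset.sum_le_sum fun j _ => ?_
  calc _ ≤ |B x i j * L (EuclideanSpace.single i 1) * L (EuclideanSpace.single j 1)| :=
        le_abs_self _
    _ = |B x i j| * (|L (EuclideanSpace.single i 1)| * |L (EuclideanSpace.single j 1)|) := by
        rw [abs_mul, abs_mul, mul_assoc]
    _ ≤ C i j * (‖L‖ * ‖L‖) := by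
        gcongr
        exacts [hC0 i j, hC i j x, hL i, hL j]
    _ = _ := by ring

theorem contDiff_flux {n : ℕ}
    {B : EuclideanSpace ℝ (Fin n) → Matrix (Fin n) (Fin n) ℝ} (hB : AdmissibleCoeff B)
    {T : EuclideanSpace ℝ (Fin n) → ℝ} (hT : ContDiff ℝ 2 T) (i : Fin n) :
    ContDiff ℝ 1 fun y => ∑ j, B y i j * fderiv ℝ T y (EuclideanSpace.single j 1) :=
  ContDiff.sum fun j _ => (hB.contDiff i j).mul
    ((hT.fderiv_right (m := 1) (by norm_num)).clm_apply contDiff_const)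

open MeasureTheory in
/-- Caccioppoli's inequality: test `L T` against `ζ² T` and absorb the mixed term
`2 ζ T ⟨B ∇T, ∇ζ⟩` in half of `ζ² ⟨B ∇T, ∇T⟩`. -/
theorem caccioppoli {n : ℕ}
    {B : EuclideanSpace ℝ (Fin n) → Matrix (Fin n) (Fin n) ℝ} (hB : AdmissibleCoeff B)
    {T ζ : EuclideanSpace ℝ (Fin n) → ℝ} (hT : ContDiff ℝ 2 T)
    (h : ∀ x, 0 ≤ T x * tangentialDivGrad B T x) (hζ : ContDiff ℝ 1 ζ)
    (hζc : HasCompactSupport ζ) :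
    ∫ x, ζ x ^ 2 * ∑ i, ∑ j, B x i j * fderiv ℝ T x (EuclideanSpace.single i 1) *
        fderiv ℝ T x (EuclideanSpace.single j 1) ≤
      4 * ∫ x, T x ^ 2 * ∑ i, ∑ j, B x i j * fderiv ℝ ζ x (EuclideanSpace.single i 1) *
        fderiv ℝ ζ x (EuclideanSpace.single j 1) := by
  let e : Fin n → EuclideanSpace ℝ (Fin n) := fun i => EuclideanSpace.single i 1
  let q : Fin n → EuclideanSpace ℝ (Fin n) → ℝ := fun i y => ∑ j, B y i j * fderiv ℝ T y (e j)
  have hq : ∀ i, ContDiff ℝ 1 (q i) := fun i => contDiff_flux hB hT i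
  have hT1 : ContDiff ℝ 1 T := hT.of_le (by norm_num)
  have hDT : Continuous (fderiv ℝ T) := hT1.continuous_fderiv one_ne_zero
  have hDζ : Continuous (fderiv ℝ ζ) := hζ.continuous_fderiv one_ne_zero
  have hBc : ∀ i j, Continuous fun x => B x i j := fun i j => (hB.contDiff i j).continuous
  -- the test function `ζ² T`
  let ψ : EuclideanSpace ℝ (Fin n) → ℝ := fun x => ζ x ^ 2 * T x
  have hψ : ContDiff ℝ 1 ψ := (hζ.pow 2).mul hT1
  have hζ2c : HasCompactSupport fun x => ζ x ^ 2 :=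
    hζc.comp_left (g := fun s : ℝ => s ^ 2) (by simp)
  have hψc : HasCompactSupport ψ := hζ2c.mul_right
  have hDψc : HasCompactSupport (fderiv ℝ ψ) := hψc.fderiv ℝ
  have hDζc : HasCompactSupport (fderiv ℝ ζ) := hζc.fderiv ℝ
  have hDψ : ∀ x v, fderiv ℝ ψ x v = 2 * ζ x * T x * fderiv ℝ ζ x v + ζ x ^ 2 * fderiv ℝ T x v := by
    intro x v
    have h1 := (((hζ.differentiable one_ne_zero x).hasFDerivAt.pow 2).mul
      (hT1.differentiable one_ne_zero x).hasFDerivAt).fderiv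
    have h2 : fderiv ℝ ψ x = _ := h1
    rw [h2]
    simp
    ring
  have hDψe : ∀ i, Continuous fun x => fderiv ℝ ψ x (e i) := fun i =>
    (hψ.continuous_fderiv one_ne_zero).clm_apply continuous_const
  have hDqe : ∀ i, Continuous fun x => fderiv ℝ (q i) x (e i) := fun i =>
    ((hq i).continuous_fderiv one_ne_zero).clm_apply continuous_const
  have hDψec : ∀ i, HasCompactSupport fun x => fderiv ℝ ψ x (e i) := fun i =>
    hDψc.comp_left (g := fun L : EuclideanSpace ℝ (Fin n) →L[ℝ] ℝ => L (e i)) (by simp)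
  have int1 : ∀ i, Integrable fun x => fderiv ℝ ψ x (e i) * q i x := fun i =>
    ((hDψe i).mul (hq i).continuous).integrable_of_hasCompactSupport (hDψec i).mul_right
  have int2 : ∀ i, Integrable fun x => ψ x * fderiv ℝ (q i) x (e i) := fun i =>
    (hψ.continuous.mul (hDqe i)).integrable_of_hasCompactSupport hψc.mul_right
  have int3 : ∀ i, Integrable fun x => ψ x * q i x := fun i =>
    (hψ.continuous.mul (hq i).continuous).integrable_of_hasCompactSupport hψc.mul_right
  have ibp : ∀ i, ∫ x, ψ x * fderiv ℝ (q i) x (e i) = -∫ x, fderiv ℝ ψ x (e i) * q i x := fun i =>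
    integral_mul_fderiv_eq_neg_fderiv_mul_of_integrable (int1 i) (int2 i) (int3 i)
      (fun x _ => hψ.differentiable one_ne_zero x)
      (fun x _ => (hq i).differentiable one_ne_zero x)
  have hG : ∫ x, ∑ i, fderiv ℝ ψ x (e i) * q i x ≤ 0 := by
    rw [integral_finsetSum _ fun i _ => int1 i, ← neg_nonneg, ← Finset.sum_neg_distrib]
    simp_rw [← ibp]
    rw [← integral_finsetSum _ fun i _ => int2 i]
    refine integral_nonneg fun x => ?_
    show 0 ≤ ∑ i, ψ x * fderiv ℝ (q i) x (e i)
    rw [← Finset.mul_sum, mul_assoc]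
    exact mul_nonneg (sq_nonneg _) (h x)
  have intT : Integrable fun x => ζ x ^ 2 * ∑ i, ∑ j, B x i j * fderiv ℝ T x (e i) *
      fderiv ℝ T x (e j) := by
    refine Continuous.integrable_of_hasCompactSupport ?_ hζ2c.mul_right
    have := hζ.continuous
    fun_prop
  have intζ : Integrable fun x => T x ^ 2 * ∑ i, ∑ j, B x i j * fderiv ℝ ζ x (e i) *
      fderiv ℝ ζ x (e j) := by
    refine Continuous.integrable_of_hasCompactSupport ?_ ?_
    · have := hT1.continuous
      fun_prop
    · refine HasCompactSupport.mul_left (hDζc.mono fun x hx => ?_)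
      rw [Function.mem_support] at hx ⊢
      contrapose! hx
      simp [hx]
  have key : ∀ x, (1 / 2) * (ζ x ^ 2 * ∑ i, ∑ j, B x i j * fderiv ℝ T x (e i) *
      fderiv ℝ T x (e j)) - 2 * (T x ^ 2 * ∑ i, ∑ j, B x i j * fderiv ℝ ζ x (e i) *
      fderiv ℝ ζ x (e j)) ≤ ∑ i, fderiv ℝ ψ x (e i) * q i x := by
    intro x
    have h1 := hB.quadraticForm_add_nonneg x (fun i => fderiv ℝ T x (e i))
      (fun i => fderiv ℝ ζ x (e i)) (ζ x) (2 * T x)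
    have h2 : ∑ i, fderiv ℝ ψ x (e i) * q i x =
        ζ x ^ 2 * (∑ i, ∑ j, B x i j * fderiv ℝ T x (e i) * fderiv ℝ T x (e j)) +
        2 * ζ x * T x * ∑ i, ∑ j, B x i j * fderiv ℝ ζ x (e i) * fderiv ℝ T x (e j) := by
      simp only [hDψ, q, Finset.mul_sum, ← Finset.sum_add_distrib]
      refine Finset.sum_congr rfl fun i _ => Finset.sum_congr rfl fun j _ => ?_
      ring
    rw [h2]
    linarith
  have := integral_mono ((intT.const_mul (1 / 2)).sub (intζ.const_mul 2))
    (integrable_finsetSum _ fun i _ => int1 i) key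
  simp only [Pi.sub_apply] at this
  rw [integral_sub (intT.const_mul (1 / 2)) (intζ.const_mul 2), integral_const_mul,
    integral_const_mul] at this
  linarith

open MeasureTheory in
/-- With cutoffs of small energy, the right-hand side of Caccioppoli's inequality tends to zero. -/
theorem fderiv_eq_zero_of_bounded {n : ℕ} (hn : n ≤ 2)
    {B : EuclideanSpace ℝ (Fin n) → Matrix (Fin n) (Fin n) ℝ} (hB : AdmissibleCoeff B)
    {T : EuclideanSpace ℝ (Fin n) → ℝ} (hT : ContDiff ℝ 2 T) {M : ℝ} (hM : ∀ x, |T x| ≤ M)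
    (h : ∀ x, 0 ≤ T x * tangentialDivGrad B T x) (x : EuclideanSpace ℝ (Fin n)) :
    fderiv ℝ T x = 0 := by
  obtain ⟨Λ, hΛ0, hΛ⟩ := hB.exists_bound
  let e : Fin n → EuclideanSpace ℝ (Fin n) := fun i => EuclideanSpace.single i 1
  set Q : EuclideanSpace ℝ (Fin n) → ℝ := fun x =>
    ∑ i, ∑ j, B x i j * fderiv ℝ T x (e i) * fderiv ℝ T x (e j) with hQ
  have hDT : Continuous (fderiv ℝ T) := hT.continuous_fderiv (by norm_num)
  have hBc : ∀ i j, Continuous fun x => B x i j := fun i j => (hB.contDiff i j).continuous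
  have hQc : Continuous Q := by fun_prop
  have hQ0 : ∀ x, 0 ≤ Q x := fun x => hB.nonneg x _
  -- it suffices that `∫ χ Q = 0` for a bump function `χ` at `x`, as `Q ≥ 0` is continuous
  let χ : ContDiffBump x := ⟨1, 2, one_pos, one_lt_two⟩
  have hfc : Continuous fun y => χ y * Q y := χ.continuous.mul hQc
  have hfs : HasCompactSupport fun y => χ y * Q y := χ.hasCompactSupport.mul_right
  have hf0 : 0 ≤ fun y => χ y * Q y := fun y => mul_nonneg χ.nonneg (hQ0 y)
  have small : ∀ ε : ℝ, 0 < ε → ∫ y, χ y * Q y ≤ 4 * (M ^ 2 * Λ * ε) := by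
    intro ε hε
    obtain ⟨ζ, hζ, hζc, hζ1, hζε⟩ := exists_cutoff_integral_sq_norm_fderiv_le
      (E := EuclideanSpace ℝ (Fin n)) (by simpa using hn) (r := ‖x‖ + 2)
      (by linarith [norm_nonneg x]) hε
    have hζ2c : HasCompactSupport fun x => ζ x ^ 2 :=
      hζc.comp_left (g := fun s : ℝ => s ^ 2) (by simp)
    have intζ : Integrable fun x => ‖fderiv ℝ ζ x‖ ^ 2 := by
      refine Continuous.integrable_of_hasCompactSupport
        ((hζ.continuous_fderiv one_ne_zero).norm.pow 2) ?_
      exact ((hζc.fderiv ℝ).norm).comp_left (g := fun s : ℝ => s ^ 2) (by simp)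
    calc ∫ y, χ y * Q y ≤ ∫ y, ζ y ^ 2 * Q y := by
          refine integral_mono (hfc.integrable_of_hasCompactSupport hfs)
            (((hζ.continuous.pow 2).mul hQc).integrable_of_hasCompactSupport hζ2c.mul_right)
            fun y => ?_
          refine mul_le_mul_of_nonneg_right ?_ (hQ0 y)
          by_cases hy : 2 ≤ dist y x
          · rw [χ.zero_of_le_dist hy]; positivity
          · rw [hζ1 y ?_, one_pow]
            · exact χ.le_one
            · rw [dist_eq_norm, not_le] at hy
              have := norm_le_norm_add_norm_sub x y
              rw [norm_sub_rev] at this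
              linarith
      _ ≤ 4 * ∫ x, T x ^ 2 * ∑ i, ∑ j, B x i j * fderiv ℝ ζ x (e i) * fderiv ℝ ζ x (e j) :=
          caccioppoli hB hT h hζ hζc
      _ ≤ 4 * ∫ x, M ^ 2 * Λ * ‖fderiv ℝ ζ x‖ ^ 2 := by
          refine mul_le_mul_of_nonneg_left ?_ (by norm_num)
          refine integral_mono_of_nonneg (Filter.Eventually.of_forall fun y => ?_)
            (intζ.const_mul _) (Filter.Eventually.of_forall fun y => ?_)
          · exact mul_nonneg (sq_nonneg _) (hB.nonneg y _)
          · show T y ^ 2 * _ ≤ M ^ 2 * Λ * ‖fderiv ℝ ζ y‖ ^ 2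
            rw [mul_assoc (M ^ 2)]
            exact mul_le_mul (sq_le_sq.2 ((hM y).trans (le_abs_self M))) (hΛ y _)
              (hB.nonneg y _) (sq_nonneg _)
      _ ≤ 4 * (M ^ 2 * Λ * ε) := by
          rw [integral_const_mul]
          gcongr
  have hQx : Q x = 0 := by
    by_contra hne
    have hpos : 0 < ∫ y, χ y * Q y := by
      refine hfc.integral_pos_of_hasCompactSupport_nonneg_nonzero hfs hf0 (x := x) ?_
      rw [χ.one_of_mem_closedBall (by simp [χ]), one_mul]
      exact hne
    -- with this choice of the energy the bound is at most half the integral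
    set I := ∫ y, χ y * Q y
    have h1 := small (I / (8 * (M ^ 2 * Λ + 1))) (by positivity)
    have h2 : 4 * (M ^ 2 * Λ * (I / (8 * (M ^ 2 * Λ + 1)))) ≤ I / 2 := by
      have h3 : 0 ≤ M ^ 2 * Λ := by positivity
      rw [← mul_div_assoc, ← mul_div_assoc, div_le_iff₀ (by positivity)]
      nlinarith
    linarith
  have hp : (fun i => fderiv ℝ T x (e i)) = 0 := by
    by_contra hne
    exact (hB.pos x _ hne).ne' hQx
  ext v
  rw [show v = ∑ i, v i • e i by
    ext k
    simp [e, Finset.sum_apply, Pi.single_apply]]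
  simp only [map_sum, map_smul]
  simp [fun i => congrFun hp i]

/-- **Liouville theorem** in dimension at most two. The hypothesis `T * L T ≥ 0` covers both the
bounded nonnegative subsolutions of `L` and the bounded solutions of `L T = μ T`, `μ > 0`. -/
theorem eq_of_bounded_of_mul_tangentialDivGrad_nonneg {n : ℕ} (hn : n ≤ 2)
    {B : EuclideanSpace ℝ (Fin n) → Matrix (Fin n) (Fin n) ℝ} (hB : AdmissibleCoeff B)
    {T : EuclideanSpace ℝ (Fin n) → ℝ} (hT : ContDiff ℝ 2 T) {M : ℝ} (hM : ∀ x, |T x| ≤ M)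
    (h : ∀ x, 0 ≤ T x * tangentialDivGrad B T x) :
    (∀ x y, T x = T y) ∧ ∀ x, tangentialDivGrad B T x = 0 := by
  have h0 := fderiv_eq_zero_of_bounded hn hB hT hM h
  refine ⟨is_const_of_fderiv_eq_zero (hT.differentiable (by norm_num)) h0, fun x => ?_⟩
  simp [tangentialDivGrad, h0]

/-! ### Calculus on the closed half space -/

/-- The derivative of `f` along `e`, taken within the closed half space, so that it is meaningful up
to the boundary. -/
noncomputable def derivAlong {n : ℕ} (e : Pt n) (f : Pt n → ℝ) (x : Pt n) : ℝ :=
  fderivWithin ℝ f (closedHalfSpace n) x e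

theorem closedHalfSpace_eq_prod (n : ℕ) : closedHalfSpace n = univ ×ˢ Ici 0 := by
  ext x; simp [closedHalfSpace]

theorem uniqueDiffOn_closedHalfSpace (n : ℕ) : UniqueDiffOn ℝ (closedHalfSpace n) := by
  rw [closedHalfSpace_eq_prod]
  exact uniqueDiffOn_univ.prod (uniqueDiffOn_Ici 0)

theorem closedHalfSpace_mem_nhds {n : ℕ} {x : Pt n} (hx : 0 < x.2) : closedHalfSpace n ∈ nhds x :=
  Filter.mem_of_superset ((isOpen_lt continuous_const continuous_snd).mem_nhds hx)
    fun y (hy : 0 < y.2) => show 0 ≤ y.2 from hy.le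

theorem ContDiffOn.derivAlong {n : ℕ} {f : Pt n → ℝ} {m k : WithTop ℕ∞}
    (hf : ContDiffOn ℝ m f (closedHalfSpace n)) (hk : k + 1 ≤ m) (e : Pt n) :
    ContDiffOn ℝ k (derivAlong e f) (closedHalfSpace n) :=
  (hf.fderivWithin (uniqueDiffOn_closedHalfSpace n) hk).clm_apply contDiffOn_const

theorem derivAlong_eq_fderiv {n : ℕ} {f : Pt n → ℝ} (e : Pt n) {x : Pt n} (hx : 0 < x.2) :
    derivAlong e f x = fderiv ℝ f x e := by
  rw [derivAlong, fderivWithin_of_mem_nhds (closedHalfSpace_mem_nhds hx)]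

/-- The derivative of `f` in the tangential variable `x'`, as a linear form on `ℝ^n`; it agrees on
`e` with `derivAlong (e, 0) f`, and serves for differentiation under the integral sign. -/
noncomputable def tangentialFDeriv {n : ℕ} {F : Type*} [NormedAddCommGroup F] [NormedSpace ℝ F]
    (f : Pt n → F) (p : Pt n) : EuclideanSpace ℝ (Fin n) →L[ℝ] F :=
  (fderivWithin ℝ f (closedHalfSpace n) p).comp
    (ContinuousLinearMap.inl ℝ (EuclideanSpace ℝ (Fin n)) ℝ)

theorem ContDiffOn.tangentialFDeriv {n : ℕ} {F : Type*} [NormedAddCommGroup F] [NormedSpace ℝ F]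
    {f : Pt n → F} {m k : WithTop ℕ∞} (hf : ContDiffOn ℝ m f (closedHalfSpace n))
    (hk : k + 1 ≤ m) : ContDiffOn ℝ k (tangentialFDeriv f) (closedHalfSpace n) :=
  (hf.fderivWithin (uniqueDiffOn_closedHalfSpace n) hk).clm_comp contDiffOn_const

/-- The slices `f (·, t)` are differentiable also for `t = 0`, because the horizontal line through a
point of the closed half space stays in it. -/
theorem hasFDerivAt_slice {n : ℕ} {F : Type*} [NormedAddCommGroup F] [NormedSpace ℝ F]
    {f : Pt n → F} (hf : ContDiffOn ℝ 1 f (closedHalfSpace n))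
    (x : EuclideanSpace ℝ (Fin n)) {t : ℝ} (ht : 0 ≤ t) :
    HasFDerivAt (fun y => f (y, t)) (tangentialFDeriv f (x, t)) x := by
  have h1 := (hf.differentiableOn one_ne_zero (x, t) ht).hasFDerivWithinAt
  have h2 : HasFDerivAt (fun y : EuclideanSpace ℝ (Fin n) => ((y, t) : Pt n))
      (ContinuousLinearMap.inl ℝ (EuclideanSpace ℝ (Fin n)) ℝ) x := hasFDerivAt_prodMk_left x t
  exact h1.comp_hasFDerivAt x h2 (Filter.Eventually.of_forall fun y => ht)

theorem hasDerivWithinAt_slice {n : ℕ} {f : Pt n → ℝ} (hf : ContDiffOn ℝ 1 f (closedHalfSpace n))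
    (x : EuclideanSpace ℝ (Fin n)) {t : ℝ} (ht : 0 ≤ t) :
    HasDerivWithinAt (fun s => f (x, s)) (derivAlong (0, 1) f (x, t)) (Ici 0) t := by
  have h1 := (hf.differentiableOn one_ne_zero (x, t) ht).hasFDerivWithinAt
  have h2 : HasDerivWithinAt (fun s : ℝ => ((x, s) : Pt n)) ((0, 1) : Pt n) (Ici 0) t :=
    ((hasDerivAt_const t x).prodMk (hasDerivAt_id t)).hasDerivWithinAt
  exact h1.comp_hasDerivWithinAt t h2 fun s hs => hs

theorem continuous_clamp {n : ℕ} {F : Type*} [TopologicalSpace F] {f : Pt n → F}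
    (hf : ContinuousOn f (closedHalfSpace n)) :
    Continuous fun p : Pt n => f (p.1, max p.2 0) :=
  hf.comp_continuous (by fun_prop) fun p => le_max_right p.2 0

theorem continuousOn_slice {n : ℕ} {F : Type*} [TopologicalSpace F] {f : Pt n → F}
    (hf : ContinuousOn f (closedHalfSpace n)) (x : EuclideanSpace ℝ (Fin n)) :
    ContinuousOn (fun t => f (x, t)) (Ici 0) :=
  hf.comp (by fun_prop) fun _ ht => ht

/-- The function `x' ↦ ∫_a^b φ(t) f(x', t) dt` of the tangential variable. -/
noncomputable def stripIntegral {n : ℕ} {F : Type*} [NormedAddCommGroup F] [NormedSpace ℝ F]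
    (φ : ℝ → ℝ) (a b : ℝ) (f : Pt n → F) (x : EuclideanSpace ℝ (Fin n)) : F :=
  ∫ t in a..b, φ t • f (x, t)

theorem stripIntegral_congr {n : ℕ} {F : Type*} [NormedAddCommGroup F] [NormedSpace ℝ F]
    {φ : ℝ → ℝ} {a b : ℝ} (ha : 0 ≤ a) (hab : a ≤ b) {f g : Pt n → F}
    (x : EuclideanSpace ℝ (Fin n)) (h : ∀ t, 0 < t → f (x, t) = g (x, t)) :
    stripIntegral φ a b f x = stripIntegral φ a b g x := by
  refine intervalIntegral.integral_congr_ae (Filter.Eventually.of_forall fun t ht => ?_)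
  rw [uIoc_of_le hab] at ht
  rw [h t (ha.trans_lt ht.1)]

theorem intervalIntegrable_slice {n : ℕ} {F : Type*} [NormedAddCommGroup F] [NormedSpace ℝ F]
    {φ : ℝ → ℝ} (hφ : Continuous φ) {a b : ℝ} (ha : 0 ≤ a) (hab : a ≤ b) {f : Pt n → F}
    (hf : ContinuousOn f (closedHalfSpace n)) (x : EuclideanSpace ℝ (Fin n)) :
    IntervalIntegrable (fun t => φ t • f (x, t)) MeasureTheory.volume a b := by
  refine ContinuousOn.intervalIntegrable ?_
  rw [uIcc_of_le hab]
  exact hφ.continuousOn.smul ((continuousOn_slice hf x).mono fun t ht => ha.trans ht.1)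

theorem continuous_stripIntegral {n : ℕ} {F : Type*} [NormedAddCommGroup F] [NormedSpace ℝ F]
    {φ : ℝ → ℝ} (hφ : Continuous φ) {a b : ℝ} (ha : 0 ≤ a) (hab : a ≤ b) {f : Pt n → F}
    (hf : ContinuousOn f (closedHalfSpace n)) : Continuous (stripIntegral φ a b f) := by
  -- composing with `t ↦ max t 0` makes the integrand continuous on the whole space
  have h : stripIntegral φ a b f = fun x => ∫ t in a..b, φ t • f (x, max t 0) := by
    ext x
    refine stripIntegral_congr (g := fun p => f (p.1, max p.2 0)) ha hab x fun t ht => ?_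
    rw [max_eq_left ht.le]
  rw [h]
  refine intervalIntegral.continuous_parametric_intervalIntegral_of_continuous' ?_ a b
  exact (hφ.comp continuous_snd).smul (continuous_clamp hf)

/-- Differentiation under the integral sign. -/
theorem hasFDerivAt_stripIntegral {n : ℕ} {F : Type*} [NormedAddCommGroup F] [NormedSpace ℝ F]
    {φ : ℝ → ℝ} (hφ : Continuous φ) {a b : ℝ} (ha : 0 ≤ a) (hab : a ≤ b) {f : Pt n → F}
    (hf : ContDiffOn ℝ 1 f (closedHalfSpace n)) (x : EuclideanSpace ℝ (Fin n)) :
    HasFDerivAt (stripIntegral φ a b f) (stripIntegral φ a b (tangentialFDeriv f) x) x := by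
  have hf' : ContinuousOn (tangentialFDeriv f) (closedHalfSpace n) :=
    (hf.tangentialFDeriv (k := 0) (by norm_num)).continuousOn
  obtain ⟨C, hC⟩ :=
    ((isCompact_closedBall x 1).prod (isCompact_Icc (a := a) (b := b))).exists_bound_of_continuousOn
    (f := fun p : Pt n => φ p.2 • tangentialFDeriv f p)
    (((hφ.comp continuous_snd).continuousOn).smul (hf'.mono fun p hp => ha.trans hp.2.1))
  refine (intervalIntegral.hasFDerivAt_integral_of_dominated_of_fderiv_le
    (F := fun x t => φ t • f (x, t)) (F' := fun x t => φ t • tangentialFDeriv f (x, t))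
    (bound := fun _ => C)
    (Metric.ball_mem_nhds x one_pos) ?_ ?_ ?_ ?_ ?_ ?_)
  · exact Filter.Eventually.of_forall fun y =>
      (intervalIntegrable_slice hφ ha hab hf.continuousOn y).def'.aestronglyMeasurable
  · exact intervalIntegrable_slice hφ ha hab hf.continuousOn x
  · exact (intervalIntegrable_slice hφ ha hab hf' x).def'.aestronglyMeasurable
  · refine Filter.Eventually.of_forall fun t ht y hy =>
      hC (y, t) ⟨Metric.ball_subset_closedBall hy, ?_⟩
    rw [uIoc_of_le hab] at ht
    exact Ioc_subset_Icc_self ht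
  · exact intervalIntegrable_const
  · refine Filter.Eventually.of_forall fun t ht y hy => ?_
    rw [uIoc_of_le hab] at ht
    exact (hasFDerivAt_slice hf y (ha.trans ht.1.le)).const_smul (φ t)

theorem contDiff_one_stripIntegral {n : ℕ} {F : Type*} [NormedAddCommGroup F] [NormedSpace ℝ F]
    {φ : ℝ → ℝ} (hφ : Continuous φ) {a b : ℝ} (ha : 0 ≤ a) (hab : a ≤ b) {f : Pt n → F}
    (hf : ContDiffOn ℝ 1 f (closedHalfSpace n)) : ContDiff ℝ 1 (stripIntegral φ a b f) := by
  rw [contDiff_one_iff_hasFDerivAt]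
  refine ⟨_, ?_, hasFDerivAt_stripIntegral hφ ha hab hf⟩
  exact continuous_stripIntegral hφ ha hab
    (hf.tangentialFDeriv (k := 0) (by norm_num)).continuousOn

theorem contDiff_two_stripIntegral {n : ℕ} {F : Type*} [NormedAddCommGroup F] [NormedSpace ℝ F]
    {φ : ℝ → ℝ} (hφ : Continuous φ) {a b : ℝ} (ha : 0 ≤ a) (hab : a ≤ b) {f : Pt n → F}
    (hf : ContDiffOn ℝ 2 f (closedHalfSpace n)) : ContDiff ℝ 2 (stripIntegral φ a b f) := by
  have hf1 : ContDiffOn ℝ 1 f (closedHalfSpace n) := hf.of_le (by norm_num)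
  have hD := hasFDerivAt_stripIntegral hφ ha hab hf1
  rw [show (2 : WithTop ℕ∞) = 1 + 1 by norm_num, contDiff_succ_iff_fderiv]
  refine ⟨fun x => (hD x).differentiableAt, by simp, ?_⟩
  rw [show fderiv ℝ (stripIntegral φ a b f) = stripIntegral φ a b (tangentialFDeriv f) from
    funext fun x => (hD x).fderiv]
  exact contDiff_one_stripIntegral hφ ha hab (hf.tangentialFDeriv (by norm_num))

theorem fderiv_stripIntegral_apply {n : ℕ}
    {φ : ℝ → ℝ} (hφ : Continuous φ) {a b : ℝ} (ha : 0 ≤ a) (hab : a ≤ b) {f : Pt n → ℝ}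
    (hf : ContDiffOn ℝ 1 f (closedHalfSpace n)) (x e : EuclideanSpace ℝ (Fin n)) :
    fderiv ℝ (stripIntegral φ a b f) x e = stripIntegral φ a b (derivAlong (e, 0) f) x := by
  have hf' : ContinuousOn (tangentialFDeriv f) (closedHalfSpace n) :=
    (hf.tangentialFDeriv (k := 0) (by norm_num)).continuousOn
  rw [(hasFDerivAt_stripIntegral hφ ha hab hf x).fderiv, stripIntegral,
    ContinuousLinearMap.intervalIntegral_apply (intervalIntegrable_slice hφ ha hab hf' x)]
  simp [stripIntegral, derivAlong, tangentialFDeriv]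

/-! ### The equation satisfied by the integrals over a strip -/

theorem tangentialDivGrad_add_const {n : ℕ}
    (B : EuclideanSpace ℝ (Fin n) → Matrix (Fin n) (Fin n) ℝ)
    (T : EuclideanSpace ℝ (Fin n) → ℝ) (κ : ℝ) (x : EuclideanSpace ℝ (Fin n)) :
    tangentialDivGrad B (fun y => T y + κ) x = tangentialDivGrad B T x := by
  simp only [tangentialDivGrad, fderiv_add_const]

theorem eq_of_bounded_of_tangentialDivGrad_nonneg {n : ℕ} (hn : n ≤ 2)
    {B : EuclideanSpace ℝ (Fin n) → Matrix (Fin n) (Fin n) ℝ} (hB : AdmissibleCoeff B)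
    {T : EuclideanSpace ℝ (Fin n) → ℝ} (hT : ContDiff ℝ 2 T) {M : ℝ} (hM : ∀ x, |T x| ≤ M)
    (h : ∀ x, 0 ≤ tangentialDivGrad B T x) :
    (∀ x y, T x = T y) ∧ ∀ x, tangentialDivGrad B T x = 0 := by
  have key := eq_of_bounded_of_mul_tangentialDivGrad_nonneg hn hB (T := fun y => T y + M)
    (hT.add contDiff_const) (M := M + |M|)
    (fun x => (abs_add_le _ _).trans (by linarith [hM x]))
    (fun x => by
      rw [tangentialDivGrad_add_const]
      exact mul_nonneg (by linarith [neg_abs_le (T x), hM x]) (h x))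
  simpa only [tangentialDivGrad_add_const, add_left_inj] using key

theorem eq_of_bounded_of_tangentialDivGrad_eq {n : ℕ} (hn : n ≤ 2)
    {B : EuclideanSpace ℝ (Fin n) → Matrix (Fin n) (Fin n) ℝ} (hB : AdmissibleCoeff B)
    {T : EuclideanSpace ℝ (Fin n) → ℝ} (hT : ContDiff ℝ 2 T) {M : ℝ} (hM : ∀ x, |T x| ≤ M)
    {μ κ : ℝ} (hμ : 0 < μ) (h : ∀ x, tangentialDivGrad B T x = μ * T x + κ) (x y) :
    T x = T y := by
  have key := eq_of_bounded_of_mul_tangentialDivGrad_nonneg hn hB (T := fun y => T y + κ / μ)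
    (hT.add contDiff_const) (M := M + |κ / μ|)
    (fun x => (abs_add_le _ _).trans (by linarith [hM x]))
    (fun x => by
      rw [tangentialDivGrad_add_const, h, show (T x + κ / μ) * (μ * T x + κ) =
        μ * (T x + κ / μ) ^ 2 by field_simp]
      positivity)
  simpa only [add_left_inj] using key.1 x y

/-- In the interior, `div (A ∇u)` expanded in terms of derivatives that extend continuously to the
boundary. -/
theorem divGrad_blockMatrix {n : ℕ}
    {B : EuclideanSpace ℝ (Fin n) → Matrix (Fin n) (Fin n) ℝ} (hB : AdmissibleCoeff B)
    {u : Pt n → ℝ} (hu : ContDiffOn ℝ 2 u (closedHalfSpace n))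
    (x : EuclideanSpace ℝ (Fin n)) {t : ℝ} (ht : 0 < t) :
    divGrad (blockMatrix B) u (x, t) =
      (∑ i, ∑ j, (fderiv ℝ (fun y => B y i j) x (EuclideanSpace.single i 1) *
          derivAlong (EuclideanSpace.single j 1, 0) u (x, t) +
        B x i j * derivAlong (EuclideanSpace.single i 1, 0)
          (derivAlong (EuclideanSpace.single j 1, 0) u) (x, t))) +
      derivAlong (0, 1) (derivAlong (0, 1) u) (x, t) := by
  have hD : ∀ e : Pt n, DifferentiableAt ℝ (derivAlong e u) (x, t) := fun e =>
    (((hu.derivAlong (k := 1) (by norm_num) e).contDiffAt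
      (closedHalfSpace_mem_nhds ht)).differentiableAt one_ne_zero)
  rw [divGrad, Fintype.sum_sum_type]
  congr 1
  · refine Finset.sum_congr rfl fun i _ => ?_
    have h1 : (fun y => ∑ j, blockMatrix B y (Sum.inl i) j * pderiv j u y) =ᶠ[nhds (x, t)]
        fun y => ∑ j, B y.1 i j * derivAlong (EuclideanSpace.single j 1, 0) u y := by
      filter_upwards [(isOpen_lt continuous_const continuous_snd).mem_nhds
        (show (0 : ℝ) < ((x, t) : Pt n).2 from ht)] with y hy
      rw [Fintype.sum_sum_type]
      simp [blockMatrix, pderiv, derivAlong_eq_fderiv _ hy, basisVec]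
    have hBd : ∀ j, HasFDerivAt (fun y : Pt n => B y.1 i j)
        ((fderiv ℝ (fun y => B y i j) x).comp (ContinuousLinearMap.fst ℝ _ ℝ)) (x, t) := fun j =>
      HasFDerivAt.comp (x, t) (g := fun y => B y i j)
        ((hB.contDiff i j).differentiable one_ne_zero x).hasFDerivAt hasFDerivAt_fst
    have h2 := (HasFDerivAt.fun_sum (u := Finset.univ) fun j _ => (hBd j).fun_mul
      (hD (EuclideanSpace.single j 1, 0)).hasFDerivAt).fderiv
    rw [pderiv, h1.fderiv_eq, h2, sum_apply]
    refine Finset.sum_congr rfl fun j _ => ?_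
    simp only [basisVec, derivAlong_eq_fderiv (x := ((x, t) : Pt n)) _ ht]
    simp
    ring
  · have h1 : (fun y => ∑ j, blockMatrix B y (Sum.inr ()) j * pderiv j u y) =ᶠ[nhds (x, t)]
        derivAlong (0, 1) u := by
      filter_upwards [(isOpen_lt continuous_const continuous_snd).mem_nhds
        (show (0 : ℝ) < ((x, t) : Pt n).2 from ht)] with y hy
      rw [Fintype.sum_sum_type]
      simp [blockMatrix, pderiv, derivAlong_eq_fderiv _ hy, basisVec]
    simp only [Finset.univ_unique, Finset.sum_singleton, PUnit.default_eq_unit]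
    rw [pderiv, h1.fderiv_eq, derivAlong_eq_fderiv _ ht]
    rfl

theorem tangentialDivGrad_stripIntegral {n : ℕ}
    {B : EuclideanSpace ℝ (Fin n) → Matrix (Fin n) (Fin n) ℝ} (hB : AdmissibleCoeff B)
    {u : Pt n → ℝ} (hu : ContDiffOn ℝ 2 u (closedHalfSpace n))
    {φ : ℝ → ℝ} (hφ : Continuous φ) {a b : ℝ} (ha : 0 ≤ a) (hab : a ≤ b)
    (x : EuclideanSpace ℝ (Fin n)) :
    tangentialDivGrad B (stripIntegral φ a b u) x = ∫ t in a..b, φ t *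
      ∑ i, ∑ j, (fderiv ℝ (fun y => B y i j) x (EuclideanSpace.single i 1) *
          derivAlong (EuclideanSpace.single j 1, 0) u (x, t) +
        B x i j * derivAlong (EuclideanSpace.single i 1, 0)
          (derivAlong (EuclideanSpace.single j 1, 0) u) (x, t)) := by
  have hu1 : ContDiffOn ℝ 1 u (closedHalfSpace n) := hu.of_le (by norm_num)
  have hD : ∀ e : Pt n, ContDiffOn ℝ 1 (derivAlong e u) (closedHalfSpace n) := fun e =>
    hu.derivAlong (by norm_num) e
  have hDD : ∀ e f : Pt n, ContDiffOn ℝ 0 (derivAlong f (derivAlong e u)) (closedHalfSpace n) :=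
    fun e f => (hD e).derivAlong (by norm_num) f
  have int1 : ∀ i j, IntervalIntegrable (fun t => φ t *
      (fderiv ℝ (fun y => B y i j) x (EuclideanSpace.single i 1) *
          derivAlong (EuclideanSpace.single j 1, 0) u (x, t))) MeasureTheory.volume a b := by
    intro i j
    have := (intervalIntegrable_slice hφ ha hab (hD (EuclideanSpace.single j 1, 0)).continuousOn
      x).const_mul (fderiv ℝ (fun y => B y i j) x (EuclideanSpace.single i 1))
    simpa only [smul_eq_mul, mul_left_comm] using this
  have int2 : ∀ i j, IntervalIntegrable (fun t => φ t *
      (B x i j * derivAlong (EuclideanSpace.single i 1, 0)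
          (derivAlong (EuclideanSpace.single j 1, 0) u) (x, t))) MeasureTheory.volume a b := by
    intro i j
    have := (intervalIntegrable_slice hφ ha hab
      (hDD (EuclideanSpace.single j 1, 0) (EuclideanSpace.single i 1, 0)).continuousOn
      x).const_mul (B x i j)
    simpa only [smul_eq_mul, mul_left_comm] using this
  have int3 : ∀ i, IntervalIntegrable (fun t => ∑ j, (φ t *
      (fderiv ℝ (fun y => B y i j) x (EuclideanSpace.single i 1) *
          derivAlong (EuclideanSpace.single j 1, 0) u (x, t)) + φ t *
      (B x i j * derivAlong (EuclideanSpace.single i 1, 0)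
          (derivAlong (EuclideanSpace.single j 1, 0) u) (x, t)))) MeasureTheory.volume a b := by
    intro i
    simpa only [Finset.sum_fn] using
      IntervalIntegrable.sum Finset.univ fun j _ => (int1 i j).add (int2 i j)
  have e1 : ∀ y e, fderiv ℝ (stripIntegral φ a b u) y e =
      stripIntegral φ a b (derivAlong (e, 0) u) y :=
    fderiv_stripIntegral_apply hφ ha hab hu1
  simp only [tangentialDivGrad, e1, Finset.mul_sum, mul_add]
  rw [intervalIntegral.integral_finsetSum fun i _ => int3 i]
  refine Finset.sum_congr rfl fun i _ => ?_
  rw [intervalIntegral.integral_finsetSum fun j _ => (int1 i j).add (int2 i j)]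
  have h2 := (HasFDerivAt.fun_sum (u := Finset.univ) fun j _ =>
    (((hB.contDiff i j).differentiable one_ne_zero x).hasFDerivAt).fun_mul
    ((contDiff_one_stripIntegral hφ ha hab
      (hD (EuclideanSpace.single j 1, 0))).differentiable one_ne_zero x).hasFDerivAt).fderiv
  rw [h2, sum_apply]
  refine Finset.sum_congr rfl fun j _ => ?_
  rw [intervalIntegral.integral_add (int1 i j) (int2 i j)]
  simp only [mul_left_comm (φ _), intervalIntegral.integral_const_mul]
  simp only [add_apply, smul_apply, smul_eq_mul,
    fderiv_stripIntegral_apply hφ ha hab (hD _)]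
  simp only [stripIntegral, smul_eq_mul]
  ring

/-- Green's formula on `[a, b]` against a solution `φ` of `φ'' = -lam φ`. -/
theorem integral_mul_deriv_deriv {y y₁ y₂ φ φ₁ : ℝ → ℝ} {a b lam : ℝ} (ha : 0 ≤ a) (hab : a ≤ b)
    (hy : ∀ t, 0 ≤ t → HasDerivWithinAt y (y₁ t) (Ici 0) t)
    (hy₁ : ∀ t, 0 ≤ t → HasDerivWithinAt y₁ (y₂ t) (Ici 0) t)
    (hy₂ : ContinuousOn y₂ (Ici 0))
    (hφ : ∀ t, HasDerivAt φ (φ₁ t) t) (hφ₁ : ∀ t, HasDerivAt φ₁ (-lam * φ t) t) :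
    ∫ t in a..b, φ t * y₂ t =
      (φ b * y₁ b - φ₁ b * y b) - (φ a * y₁ a - φ₁ a * y a) - lam * ∫ t in a..b, φ t * y t := by
  have hsub : uIcc a b ⊆ Ici 0 := by
    rw [uIcc_of_le hab]; exact fun t ht => ha.trans ht.1
  have hyc : ContinuousOn y (Ici 0) := fun t ht => (hy t ht).continuousWithinAt
  have hy₁c : ContinuousOn y₁ (Ici 0) := fun t ht => (hy₁ t ht).continuousWithinAt
  have hφc : Continuous φ := continuous_iff_continuousAt.2 fun t => (hφ t).continuousAt
  have hφ₁c : Continuous φ₁ := continuous_iff_continuousAt.2 fun t => (hφ₁ t).continuousAt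
  have i2 : IntervalIntegrable (fun t => φ t * y₂ t) MeasureTheory.volume a b :=
    (hφc.continuousOn.mul (hy₂.mono hsub)).intervalIntegrable
  have i0 : IntervalIntegrable (fun t => lam * (φ t * y t)) MeasureTheory.volume a b :=
    (continuousOn_const.mul (hφc.continuousOn.mul (hyc.mono hsub))).intervalIntegrable
  have ftc := intervalIntegral.integral_eq_sub_of_hasDeriv_right
    (f := fun t => φ t * y₁ t - φ₁ t * y t) (f' := fun t => φ t * y₂ t + lam * (φ t * y t))
    ((hφc.continuousOn.mul (hy₁c.mono hsub)).sub (hφ₁c.continuousOn.mul (hyc.mono hsub)))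
    (fun t ht => by
      rw [min_eq_left hab, max_eq_right hab] at ht
      have ht0 : 0 ≤ t := ha.trans ht.1.le
      have hs : Ioi t ⊆ Ici 0 := fun s hs => ht0.trans (le_of_lt hs)
      have := ((hφ t).hasDerivWithinAt.mul ((hy₁ t ht0).mono hs)).sub
        ((hφ₁ t).hasDerivWithinAt.mul ((hy t ht0).mono hs))
      convert! this using 1
      ring) (i2.add i0)
  rw [intervalIntegral.integral_add i2 i0, intervalIntegral.integral_const_mul] at ftc
  linarith

/-- The equation tested against `φ (x_N)` with `φ'' = -lam φ` becomes an equation in `x'` for the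
integral of `u φ` over a strip. -/
theorem tangentialDivGrad_stripIntegral_of_isClassicalSolution {n : ℕ}
    {B : EuclideanSpace ℝ (Fin n) → Matrix (Fin n) (Fin n) ℝ} (hB : AdmissibleCoeff B)
    {g : ℝ → ℝ} (hg : Continuous g)
    {u : Pt n → ℝ} (hu : IsClassicalSolution (blockMatrix B) g u)
    {φ φ₁ : ℝ → ℝ} {a b lam : ℝ} (ha : 0 ≤ a) (hab : a ≤ b)
    (hφ : ∀ t, HasDerivAt φ (φ₁ t) t) (hφ₁ : ∀ t, HasDerivAt φ₁ (-lam * φ t) t)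
    (x : EuclideanSpace ℝ (Fin n)) :
    tangentialDivGrad B (stripIntegral φ a b u) x =
      (lam - 1) * stripIntegral φ a b u x + (∫ t in a..b, φ t * g t) -
      ((φ b * derivAlong (0, 1) u (x, b) - φ₁ b * u (x, b)) -
        (φ a * derivAlong (0, 1) u (x, a) - φ₁ a * u (x, a))) := by
  have hφc : Continuous φ := continuous_iff_continuousAt.2 fun t => (hφ t).continuousAt
  have hu2 := hu.contDiffOn
  have hu1 : ContDiffOn ℝ 1 u (closedHalfSpace n) := hu2.of_le (by norm_num)
  have hD : ContDiffOn ℝ 1 (derivAlong (0, 1) u) (closedHalfSpace n) :=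
    hu2.derivAlong (by norm_num) _
  have hDD : ContDiffOn ℝ 0 (derivAlong (0, 1) (derivAlong (0, 1) u)) (closedHalfSpace n) :=
    hD.derivAlong (by norm_num) _
  have green := integral_mul_deriv_deriv ha hab (fun t ht => hasDerivWithinAt_slice hu1 x ht)
    (fun t ht => hasDerivWithinAt_slice hD x ht) (continuousOn_slice hDD.continuousOn x) hφ hφ₁
  have i1 := intervalIntegrable_slice hφc ha hab hu1.continuousOn x
  have i2 := intervalIntegrable_slice hφc ha hab hDD.continuousOn x
  have i3 : IntervalIntegrable (fun t => φ t * g t) MeasureTheory.volume a b :=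
    (hφc.mul hg).intervalIntegrable a b
  simp only [smul_eq_mul] at i1 i2
  rw [tangentialDivGrad_stripIntegral hB hu2 hφc ha hab x]
  have e : ∫ t in a..b, φ t *
      ∑ i, ∑ j, (fderiv ℝ (fun y => B y i j) x (EuclideanSpace.single i 1) *
          derivAlong (EuclideanSpace.single j 1, 0) u (x, t) +
        B x i j * derivAlong (EuclideanSpace.single i 1, 0)
          (derivAlong (EuclideanSpace.single j 1, 0) u) (x, t)) =
      ∫ t in a..b, (φ t * g t - φ t * u (x, t) -
        φ t * derivAlong (0, 1) (derivAlong (0, 1) u) (x, t)) := by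
    refine intervalIntegral.integral_congr_ae (Filter.Eventually.of_forall fun t ht => ?_)
    rw [uIoc_of_le hab] at ht
    have ht0 : 0 < t := ha.trans_lt ht.1
    have h1 := hu.eqn (x, t) ht0
    rw [divGrad_blockMatrix hB hu2 x ht0] at h1
    rw [← mul_sub, ← mul_sub]
    congr 1
    linarith
  rw [e, intervalIntegral.integral_sub (i3.sub i1) i2, intervalIntegral.integral_sub i3 i1, green]
  simp only [stripIntegral, smul_eq_mul]
  ring

/-! ### Fourier series of real functions on an interval of length `2π` -/

/-- The complex Fourier coefficients of a real function in terms of sine and cosine integrals. -/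
theorem fourierCoeffOn_ofReal {f : ℝ → ℝ} {a : ℝ}
    (hf : ContinuousOn f (Icc a (a + 2 * π))) (n : ℤ) :
    fourierCoeffOn (lt_add_of_pos_right a two_pi_pos) (fun t => (f t : ℂ)) n =
      (1 / (2 * π) : ℝ) * (((∫ t in a..a + 2 * π, f t * cos (n * t) : ℝ) : ℂ) -
        ((∫ t in a..a + 2 * π, f t * sin (n * t) : ℝ) : ℂ) * Complex.I) := by
  have hle : a ≤ a + 2 * π := by linarith [two_pi_pos]
  have ic : IntervalIntegrable (fun t => ((f t * cos (n * t) : ℝ) : ℂ)) MeasureTheory.volume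
      a (a + 2 * π) := by
    refine (Complex.continuous_ofReal.comp_continuousOn ?_).intervalIntegrable
    rw [uIcc_of_le hle]
    exact hf.mul (by fun_prop)
  have is : IntervalIntegrable (fun t => ((f t * sin (n * t) : ℝ) : ℂ)) MeasureTheory.volume
      a (a + 2 * π) := by
    refine (Complex.continuous_ofReal.comp_continuousOn ?_).intervalIntegrable
    rw [uIcc_of_le hle]
    exact hf.mul (by fun_prop)
  rw [fourierCoeffOn_eq_integral, add_sub_cancel_left, ← intervalIntegral.integral_ofReal,
    ← intervalIntegral.integral_ofReal, ← intervalIntegral.integral_mul_const,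
    ← intervalIntegral.integral_sub ic (is.mul_const _), Complex.real_smul]
  congr 1
  refine intervalIntegral.integral_congr fun t _ => ?_
  have hπ : (π : ℂ) ≠ 0 := Complex.ofReal_ne_zero.2 pi_ne_zero
  have e : (2 * π * Complex.I * ((-n : ℤ) : ℂ) * t / ((2 * π : ℝ) : ℂ) : ℂ) =
      (-(n * t : ℝ) : ℂ) * Complex.I := by
    push_cast
    field_simp
  show fourier (-n) (t : AddCircle (2 * π)) • (f t : ℂ) = _
  rw [fourier_coe_apply, e, Complex.exp_mul_I, Complex.cos_neg, Complex.sin_neg, smul_eq_mul,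
    ← Complex.ofReal_cos, ← Complex.ofReal_sin]
  push_cast
  ring

/-- A Fourier series with summable coefficients converges to the function, in real form. The term
`m = 0` contributes twice the mean value, whence the additional summand in the limit. -/
theorem hasSum_fourier_real {f : ℝ → ℝ} {a : ℝ}
    (hf : ContinuousOn f (Icc a (a + 2 * π))) (hfa : f a = f (a + 2 * π))
    (hC : Summable fun m : ℕ => ∫ s in a..a + 2 * π, f s * cos (m * s))
    (hS : Summable fun m : ℕ => ∫ s in a..a + 2 * π, f s * sin (m * s))
    {t : ℝ} (ht : t ∈ Icc a (a + 2 * π)) :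
    HasSum (fun m : ℕ => 1 / π * ((∫ s in a..a + 2 * π, f s * cos (m * s)) * cos (m * t) +
        (∫ s in a..a + 2 * π, f s * sin (m * s)) * sin (m * t)))
      (f t + 1 / (2 * π) * ∫ s in a..a + 2 * π, f s) := by
  have hT : Fact (0 < 2 * π) := ⟨two_pi_pos⟩
  let F : C(AddCircle (2 * π), ℂ) := ⟨AddCircle.liftIco (2 * π) a fun t => (f t : ℂ),
    AddCircle.liftIco_continuous (by simpa using hfa)
      (Complex.continuous_ofReal.comp_continuousOn hf)⟩
  have hF : ∀ n, fourierCoeff F n = (1 / (2 * π) : ℝ) *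
      (((∫ t in a..a + 2 * π, f t * cos (n * t) : ℝ) : ℂ) -
        ((∫ t in a..a + 2 * π, f t * sin (n * t) : ℝ) : ℂ) * Complex.I) := fun n => by
    rw [← fourierCoeffOn_ofReal hf n, ← fourierCoeff_liftIco_eq]
    rfl
  have hFt : F (t : AddCircle (2 * π)) = f t := by
    rcases ht.2.lt_or_eq with h | h
    · exact AddCircle.liftIco_coe_apply (f := fun t => (f t : ℂ)) ⟨ht.1, h⟩
    · have : ((t : ℝ) : AddCircle (2 * π)) = (a : ℝ) := by
        rw [h, AddCircle.coe_add_period]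
      rw [this, h, ← hfa]
      exact AddCircle.liftIco_coe_apply (f := fun t => (f t : ℂ))
        ⟨le_rfl, lt_add_of_pos_right a two_pi_pos⟩
  have hC' := Complex.ofRealCLM.summable hC
  have hS' := Complex.ofRealCLM.summable hS
  have hsum : Summable (fourierCoeff F) := by
    refine Summable.of_nat_of_neg ?_ ?_
    · refine ((hC'.sub (hS'.mul_right Complex.I)).mul_left ((1 / (2 * π) : ℝ) : ℂ)).congr
        fun m => ?_
      simp [hF]
    · refine ((hC'.add (hS'.mul_right Complex.I)).mul_left ((1 / (2 * π) : ℝ) : ℂ)).congr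
        fun m => ?_
      simp [hF]
  have key :=
    (has_pointwise_sum_fourier_series_of_summable hsum (t : AddCircle (2 * π))).nat_add_neg
  have key2 := Complex.reCLM.hasSum key
  have hfour : ∀ n : ℤ, fourier n (t : AddCircle (2 * π)) =
      (cos (n * t) : ℂ) + (sin (n * t) : ℂ) * Complex.I := by
    intro n
    have hπ : (π : ℂ) ≠ 0 := Complex.ofReal_ne_zero.2 pi_ne_zero
    rw [fourier_coe_apply, show (2 * π * Complex.I * (n : ℂ) * t / ((2 * π : ℝ) : ℂ) : ℂ) =
      (n * t : ℂ) * Complex.I by push_cast; field_simp, Complex.exp_mul_I]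
    push_cast
    ring
  convert! key2 using 1
  · funext m
    simp only [Complex.reCLM_apply, hF, hfour, smul_eq_mul, Int.cast_neg, Int.cast_natCast,
      neg_mul, mul_neg, cos_neg, sin_neg, intervalIntegral.integral_neg]
    simp
    rw [show Complex.cos (m * t) = ((cos (m * t) : ℝ) : ℂ) by push_cast; rfl,
      show Complex.sin (m * t) = ((sin (m * t) : ℝ) : ℂ) by push_cast; rfl,
      Complex.ofReal_re, Complex.ofReal_re]
    field_simp
    ring
  · simp [hF, hFt]

/-- A continuous function whose Fourier coefficients of positive frequency vanish is constant. -/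
theorem eq_of_fourier_integrals_eq_zero {f : ℝ → ℝ} {a : ℝ}
    (hf : ContinuousOn f (Icc a (a + 2 * π))) (hfa : f a = f (a + 2 * π))
    (hC : ∀ m : ℕ, m ≠ 0 → ∫ s in a..a + 2 * π, f s * cos (m * s) = 0)
    (hS : ∀ m : ℕ, m ≠ 0 → ∫ s in a..a + 2 * π, f s * sin (m * s) = 0)
    {t : ℝ} (ht : t ∈ Icc a (a + 2 * π)) : f t = f a := by
  have hS' : ∀ m : ℕ, ∫ s in a..a + 2 * π, f s * sin (m * s) = 0 := fun m => by
    by_cases hm : m = 0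
    · simp [hm]
    · exact hS m hm
  have hC' : ∀ m ∉ ({0} : Finset ℕ), ∫ s in a..a + 2 * π, f s * cos (m * s) = 0 := fun m hm =>
    hC m (by simpa using hm)
  have sC : Summable fun m : ℕ => ∫ s in a..a + 2 * π, f s * cos (m * s) :=
    (hasSum_sum_of_ne_finset_zero hC').summable
  have sS : Summable fun m : ℕ => ∫ s in a..a + 2 * π, f s * sin (m * s) := by
    simp only [hS']; exact summable_zero
  have key : ∀ t ∈ Icc a (a + 2 * π), f t + 1 / (2 * π) * ∫ s in a..a + 2 * π, f s =
      1 / π * ∫ s in a..a + 2 * π, f s := by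
    intro t ht
    have h0 := hasSum_single (f := fun m : ℕ =>
      1 / π * ((∫ s in a..a + 2 * π, f s * cos (m * s)) * cos (m * t) +
        (∫ s in a..a + 2 * π, f s * sin (m * s)) * sin (m * t))) 0
      fun m hm => by simp only [hC m hm, hS' m]; ring
    rw [(hasSum_fourier_real hf hfa sC sS ht).unique h0]
    simp
  have h1 := key t ht
  have h2 := key a ⟨le_rfl, by linarith [two_pi_pos]⟩
  linarith

/-- Bessel's inequality, as a summability statement. -/
theorem summable_sq_cosCoeff_add_sq_sinCoeff {g : ℝ → ℝ} (hg : Continuous g) :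
    Summable fun m : ℕ => cosCoeff g m ^ 2 + sinCoeff g m ^ 2 := by
  have hπ : (0 : ℝ) < 2 * π := two_pi_pos
  have hL2 : MeasureTheory.MemLp (fun t => (g t : ℂ)) 2
      (MeasureTheory.volume.restrict (Ioc 0 (0 + 2 * π))) := by
    have hc : Continuous fun t => (g t : ℂ) := by fun_prop
    obtain ⟨C, hC⟩ := (isCompact_Icc (a := (0 : ℝ)) (b := 0 + 2 * π)).exists_bound_of_continuousOn
      hc.continuousOn
    refine MeasureTheory.MemLp.of_bound hc.aestronglyMeasurable C ?_
    filter_upwards [MeasureTheory.ae_restrict_mem measurableSet_Ioc] with t ht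
    exact hC t (Ioc_subset_Icc_self ht)
  have h := (hasSum_sq_fourierCoeffOn (lt_add_of_pos_right 0 hπ) hL2).summable
  have h2 := (h.comp_injective (i := fun m : ℕ => (m : ℤ)) Nat.cast_injective).mul_left 4
  refine Summable.of_nonneg_of_le (fun m => by positivity) (fun m => ?_) h2
  have h3 := fourierCoeffOn_ofReal (a := 0) hg.continuousOn (m : ℤ)
  have h4 : ∀ r c s : ℝ, ‖(r : ℂ) * ((c : ℂ) - (s : ℂ) * Complex.I)‖ ^ 2 =
      r ^ 2 * (c ^ 2 + s ^ 2) := fun r c s => by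
    rw [← Complex.normSq_eq_norm_sq]
    simp [Complex.normSq_apply]
    ring
  simp only [Function.comp]
  rw [h3, h4, zero_add, cosCoeff, sinCoeff, Int.cast_natCast]
  refine le_of_eq ?_
  ring

theorem summable_sq_cosCoeff {g : ℝ → ℝ} (hg : Continuous g) :
    Summable fun m : ℕ => cosCoeff g m ^ 2 :=
  (summable_sq_cosCoeff_add_sq_sinCoeff hg).of_nonneg_of_le (fun _ => sq_nonneg _)
    fun _ => le_add_of_nonneg_right (sq_nonneg _)

theorem summable_sq_sinCoeff {g : ℝ → ℝ} (hg : Continuous g) :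
    Summable fun m : ℕ => sinCoeff g m ^ 2 :=
  (summable_sq_cosCoeff_add_sq_sinCoeff hg).of_nonneg_of_le (fun _ => sq_nonneg _)
    fun _ => le_add_of_nonneg_left (sq_nonneg _)

/-! ### One-dimensional symmetry on a strip -/

theorem integral_mul_cos_eq {g : ℝ → ℝ} (hper : Function.Periodic g (2 * π)) (m : ℕ) (a : ℝ) :
    ∫ t in a..a + 2 * π, cos (m * t) * g t = π * cosCoeff g m := by
  have hp : Function.Periodic (fun t => cos (m * t) * g t) (2 * π) := fun t => by
    show cos (m * (t + 2 * π)) * g (t + 2 * π) = _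
    rw [hper, mul_add, cos_add_nat_mul_two_pi]
  rw [hp.intervalIntegral_add_eq a 0, zero_add, cosCoeff, ← mul_assoc,
    mul_one_div_cancel pi_ne_zero, one_mul]
  simp only [mul_comm]

theorem integral_mul_sin_eq {g : ℝ → ℝ} (hper : Function.Periodic g (2 * π)) (m : ℕ) (a : ℝ) :
    ∫ t in a..a + 2 * π, sin (m * t) * g t = π * sinCoeff g m := by
  have hp : Function.Periodic (fun t => sin (m * t) * g t) (2 * π) := fun t => by
    show sin (m * (t + 2 * π)) * g (t + 2 * π) = _
    rw [hper, mul_add, sin_add_nat_mul_two_pi]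
  rw [hp.intervalIntegral_add_eq a 0, zero_add, sinCoeff, ← mul_assoc,
    mul_one_div_cancel pi_ne_zero, one_mul]
  simp only [mul_comm]

theorem hasDerivAt_sin_mul (k t : ℝ) : HasDerivAt (fun t => sin (k * t)) (k * cos (k * t)) t := by
  have := (hasDerivAt_sin (k * t)).comp t ((hasDerivAt_id t).const_mul k)
  simpa [mul_comm, Function.comp_def] using this

theorem hasDerivAt_cos_mul (k t : ℝ) : HasDerivAt (fun t => cos (k * t)) (-k * sin (k * t)) t := by
  have := (hasDerivAt_cos (k * t)).comp t ((hasDerivAt_id t).const_mul k)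
  simpa [mul_comm, Function.comp_def] using this

theorem abs_stripIntegral_le {n : ℕ} {u : Pt n → ℝ} {φ : ℝ → ℝ} {a b C : ℝ} (hab : a ≤ b)
    (hφ : ∀ t, |φ t| ≤ 1) (x : EuclideanSpace ℝ (Fin n))
    (hu : ∀ t ∈ Icc a b, 0 ≤ u (x, t) ∧ u (x, t) ≤ C) :
    |stripIntegral φ a b u x| ≤ C * (b - a) := by
  have := intervalIntegral.norm_integral_le_of_norm_le_const (f := fun t => φ t • u (x, t)) (a := a)
    (b := b) (C := C) fun t ht => by
      rw [uIoc_of_le hab] at ht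
      have h := hu t (Ioc_subset_Icc_self ht)
      rw [norm_smul, Real.norm_eq_abs, Real.norm_of_nonneg h.1]
      calc |φ t| * u (x, t) ≤ 1 * u (x, t) := mul_le_mul_of_nonneg_right (hφ t) h.1
        _ ≤ C := by rw [one_mul]; exact h.2
  rwa [abs_of_nonneg (sub_nonneg.2 hab)] at this

/-- On a strip of height `2π` starting at a multiple of `2π` where `u = 0`: the first Fourier
coefficients of `g` vanish, the Cauchy data of `u` at both ends are zero (the normal derivative is
recorded at the lower end), and `u` does not depend on `x'`. -/
theorem strip_symmetry {n : ℕ} (hn : n ≤ 2)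
    {B : EuclideanSpace ℝ (Fin n) → Matrix (Fin n) (Fin n) ℝ} (hB : AdmissibleCoeff B)
    {g : ℝ → ℝ} (hg : Continuous g) (hper : Function.Periodic g (2 * π))
    (hc : 0 ≤ cosCoeff g 1) (hd : 0 ≤ sinCoeff g 1)
    {u : Pt n → ℝ} (hu : IsClassicalSolution (blockMatrix B) g u) (hub : NonnegBoundedOnStrips u)
    (j : ℕ) (h0 : ∀ x, u (x, j * (2 * π)) = 0) :
    (cosCoeff g 1 = 0 ∧ sinCoeff g 1 = 0) ∧
      (∀ x, derivAlong (0, 1) u (x, j * (2 * π)) = 0) ∧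
      (∀ x, u (x, j * (2 * π) + 2 * π) = 0) ∧
      ∀ x y, ∀ t ∈ Icc (j * (2 * π)) (j * (2 * π) + 2 * π), u (x, t) = u (y, t) := by
  set a : ℝ := j * (2 * π) with ha
  have hπ := two_pi_pos
  have ha0 : 0 ≤ a := by positivity
  have hab : a ≤ a + 2 * π := by linarith
  have hsa : ∀ k : ℕ, sin (k * a) = 0 := fun k => by
    rw [ha, show (k : ℝ) * (j * (2 * π)) = ((2 * (k * j) : ℕ) : ℝ) * π by push_cast; ring]
    exact sin_nat_mul_pi _
  have hca : ∀ k : ℕ, cos (k * a) = 1 := fun k => by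
    rw [ha, show (k : ℝ) * (j * (2 * π)) = ((k * j : ℕ) : ℝ) * (2 * π) by push_cast; ring]
    exact cos_nat_mul_two_pi _
  have hsb : ∀ k : ℕ, sin (k * (a + 2 * π)) = 0 := fun k => by
    rw [mul_add, sin_add_nat_mul_two_pi, hsa]
  have hcb : ∀ k : ℕ, cos (k * (a + 2 * π)) = 1 := fun k => by
    rw [mul_add, cos_add_nat_mul_two_pi, hca]
  obtain ⟨C, -, hC⟩ := hub (a + 2 * π) (by linarith)
  have hC' : ∀ x, ∀ t ∈ Icc a (a + 2 * π), 0 ≤ u (x, t) ∧ u (x, t) ≤ C := fun x t ht =>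
    hC x t ⟨ha0.trans ht.1, ht.2⟩
  have hpos : ∀ x t, 0 ≤ t → 0 ≤ u (x, t) := fun x t ht => by
    obtain ⟨K, -, hK⟩ := hub (t + 1) (by linarith)
    exact (hK x t ⟨ht, by linarith⟩).1
  have hu1 : ContDiffOn ℝ 1 u (closedHalfSpace n) := hu.contDiffOn.of_le (by norm_num)
  -- the integrals of `u` against `sin (k t)` and `cos (k t)` over the strip
  let S : ℕ → EuclideanSpace ℝ (Fin n) → ℝ := fun k =>
    stripIntegral (fun t => sin (k * t)) a (a + 2 * π) u
  let K : ℕ → EuclideanSpace ℝ (Fin n) → ℝ := fun k =>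
    stripIntegral (fun t => cos (k * t)) a (a + 2 * π) u
  have hS2 : ∀ k, ContDiff ℝ 2 (S k) := fun k =>
    contDiff_two_stripIntegral (by fun_prop) ha0 hab hu.contDiffOn
  have hK2 : ∀ k, ContDiff ℝ 2 (K k) := fun k =>
    contDiff_two_stripIntegral (by fun_prop) ha0 hab hu.contDiffOn
  have hSb : ∀ k x, |S k x| ≤ C * (a + 2 * π - a) := fun k x =>
    abs_stripIntegral_le hab (fun t => abs_sin_le_one _) x (hC' x)
  have hKb : ∀ k x, |K k x| ≤ C * (a + 2 * π - a) := fun k x =>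
    abs_stripIntegral_le hab (fun t => abs_cos_le_one _) x (hC' x)
  have hSL : ∀ (k : ℕ) x, tangentialDivGrad B (S k) x =
      ((k : ℝ) ^ 2 - 1) * S k x + π * sinCoeff g k + k * u (x, a + 2 * π) := by
    intro k x
    have := tangentialDivGrad_stripIntegral_of_isClassicalSolution hB hg hu (lam := (k : ℝ) ^ 2)
      ha0 hab (hasDerivAt_sin_mul k)
      (fun t => ((hasDerivAt_cos_mul k t).const_mul (k : ℝ)).congr_deriv (by ring)) x
    rw [integral_mul_sin_eq hper, hsa, hsb, hcb, h0] at this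
    show tangentialDivGrad B (stripIntegral _ a (a + 2 * π) u) x = _
    rw [this]
    ring
  have hKL : ∀ (k : ℕ) x, tangentialDivGrad B (K k) x =
      ((k : ℝ) ^ 2 - 1) * K k x + π * cosCoeff g k +
        (derivAlong (0, 1) u (x, a) - derivAlong (0, 1) u (x, a + 2 * π)) := by
    intro k x
    have := tangentialDivGrad_stripIntegral_of_isClassicalSolution hB hg hu (lam := (k : ℝ) ^ 2)
      ha0 hab (hasDerivAt_cos_mul k)
      (fun t => ((hasDerivAt_sin_mul k t).const_mul (-k : ℝ)).congr_deriv (by ring)) x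
    rw [integral_mul_cos_eq hper, hsa, hsb, hca, hcb, h0] at this
    show tangentialDivGrad B (stripIntegral _ a (a + 2 * π) u) x = _
    rw [this]
    ring
  have hS1 := eq_of_bounded_of_tangentialDivGrad_nonneg hn hB (hS2 1) (hSb 1) fun x => by
    rw [hSL]
    have := hpos x (a + 2 * π) (by linarith)
    push_cast
    nlinarith [pi_pos]
  have hzero : ∀ x, π * sinCoeff g 1 = 0 ∧ u (x, a + 2 * π) = 0 := by
    intro x
    have h1 := hS1.2 x
    rw [hSL] at h1
    push_cast at h1
    have h2 := hpos x (a + 2 * π) (by linarith)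
    have h3 : 0 ≤ π * sinCoeff g 1 := mul_nonneg pi_pos.le hd
    constructor <;> linarith
  have hd0 : sinCoeff g 1 = 0 := (mul_eq_zero.1 (hzero 0).1).resolve_left pi_ne_zero
  have hub0 : ∀ x, u (x, a + 2 * π) = 0 := fun x => (hzero x).2
  -- `u ≥ 0` attains its minimum at the interior height `a + 2π`
  have hDb : ∀ x, derivAlong (0, 1) u (x, a + 2 * π) = 0 := by
    intro x
    have hmem : Ici (0 : ℝ) ∈ nhds (a + 2 * π) := Ici_mem_nhds (by linarith)
    have h1 := (hasDerivWithinAt_slice hu1 x (t := a + 2 * π) (by linarith)).hasDerivAt hmem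
    refine IsLocalMin.hasDerivAt_eq_zero ?_ h1
    filter_upwards [hmem] with t ht
    rw [hub0]
    exact hpos x t ht
  -- `u` vanishes at height `a` and is nonnegative above it
  have hDa : ∀ x, 0 ≤ derivAlong (0, 1) u (x, a) := by
    intro x
    have h1 := (hasDerivWithinAt_slice hu1 x ha0).mono (Ici_subset_Ici.2 ha0)
    have h2 := h1.Ioi_of_Ici
    rw [hasDerivWithinAt_iff_tendsto_slope' (by simp)] at h2
    refine ge_of_tendsto h2 ?_
    filter_upwards [self_mem_nhdsWithin] with t ht
    rw [slope_def_field, h0, sub_zero]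
    exact div_nonneg (hpos x t (ha0.trans (le_of_lt ht))) (sub_nonneg.2 (le_of_lt ht))
  have hK1 := eq_of_bounded_of_tangentialDivGrad_nonneg hn hB (hK2 1) (hKb 1) fun x => by
    rw [hKL, hDb]
    have := hDa x
    push_cast
    nlinarith [pi_pos]
  have hzero' : ∀ x, π * cosCoeff g 1 = 0 ∧ derivAlong (0, 1) u (x, a) = 0 := by
    intro x
    have h1 := hK1.2 x
    rw [hKL, hDb] at h1
    push_cast at h1
    have h2 := hDa x
    have h3 : 0 ≤ π * cosCoeff g 1 := mul_nonneg pi_pos.le hc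
    constructor <;> linarith
  have hc0 : cosCoeff g 1 = 0 := (mul_eq_zero.1 (hzero' 0).1).resolve_left pi_ne_zero
  have hDa0 : ∀ x, derivAlong (0, 1) u (x, a) = 0 := fun x => (hzero' x).2
  have hk2 : ∀ k : ℕ, 2 ≤ k → (0 : ℝ) < (k : ℝ) ^ 2 - 1 := fun k hk => by
    have : (2 : ℝ) ≤ k := by exact_mod_cast hk
    nlinarith
  have hSconst : ∀ k : ℕ, k ≠ 0 → ∀ x y, S k x = S k y := by
    intro k hk
    rcases (Nat.one_le_iff_ne_zero.2 hk).eq_or_lt with rfl | hk'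
    · exact hS1.1
    · exact eq_of_bounded_of_tangentialDivGrad_eq hn hB (hS2 k) (hSb k) (hk2 k hk')
        (κ := π * sinCoeff g k) fun x => by rw [hSL, hub0, mul_zero, add_zero]
  have hKconst : ∀ k : ℕ, k ≠ 0 → ∀ x y, K k x = K k y := by
    intro k hk
    rcases (Nat.one_le_iff_ne_zero.2 hk).eq_or_lt with rfl | hk'
    · exact hK1.1
    · exact eq_of_bounded_of_tangentialDivGrad_eq hn hB (hK2 k) (hKb k) (hk2 k hk')
        (κ := π * cosCoeff g k) fun x => by rw [hKL, hDb, hDa0, sub_zero, add_zero]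
  refine ⟨⟨hc0, hd0⟩, hDa0, hub0, fun x y t ht => ?_⟩
  have hcont : ∀ x, ContinuousOn (fun t => u (x, t)) (Icc a (a + 2 * π)) := fun x =>
    (continuousOn_slice hu1.continuousOn x).mono fun t ht => ha0.trans ht.1
  have key : ∀ φ : ℝ → ℝ, Continuous φ →
      stripIntegral φ a (a + 2 * π) u x = stripIntegral φ a (a + 2 * π) u y →
      ∫ s in a..a + 2 * π, (u (x, s) - u (y, s)) * φ s = 0 := by
    intro φ hφ h
    have i1 := intervalIntegrable_slice hφ ha0 hab hu1.continuousOn x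
    have i2 := intervalIntegrable_slice hφ ha0 hab hu1.continuousOn y
    rw [← sub_eq_zero, stripIntegral, stripIntegral, ← intervalIntegral.integral_sub i1 i2] at h
    rw [← h]
    refine intervalIntegral.integral_congr fun s _ => ?_
    simp only [smul_eq_mul]
    ring
  have := eq_of_fourier_integrals_eq_zero (f := fun s => u (x, s) - u (y, s))
    ((hcont x).sub (hcont y)) (by simp only [h0, hub0])
    (fun m hm => key _ (by fun_prop) (hKconst m hm x y))
    (fun m hm => key _ (by fun_prop) (hSconst m hm x y)) ht
  simp only [h0, sub_self] at this
  exact sub_eq_zero.1 this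

/-! ### The one-dimensional problem -/

/-- Uniqueness for `z'' = -z` on `[0, ∞)`, from conservation of `z² + z'²`. -/
theorem eq_zero_of_harmonic_oscillator {z z₁ : ℝ → ℝ}
    (hz : ∀ t, 0 ≤ t → HasDerivWithinAt z (z₁ t) (Ici 0) t)
    (hz₁ : ∀ t, 0 ≤ t → HasDerivWithinAt z₁ (-z t) (Ici 0) t)
    (h0 : z 0 = 0) (h1 : z₁ 0 = 0) {t : ℝ} (ht : 0 ≤ t) : z t = 0 := by
  have hd : ∀ s, 0 ≤ s → HasDerivWithinAt (fun s => z s ^ 2 + z₁ s ^ 2) 0 (Ici 0) s := by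
    intro s hs
    refine (((hz s hs).pow 2).add ((hz₁ s hs).pow 2)).congr_deriv ?_
    push_cast
    ring
  have := constant_of_has_deriv_right_zero (a := 0) (b := t)
    (fun s hs => ((hd s hs.1).continuousWithinAt).mono fun r hr => hr.1)
    (fun s hs => (hd s hs.1).mono (Ici_subset_Ici.2 hs.1)) t ⟨ht, le_rfl⟩
  simp only [h0, h1] at this
  nlinarith [sq_nonneg (z t), sq_nonneg (z₁ t)]

/-- A solution of the one-dimensional problem as a first-order system on the closed half line; the
equation extends to `t = 0` by continuity. -/
theorem IsODESolution.exists_deriv {g w : ℝ → ℝ} (hg : Continuous g) (hw : IsODESolution g w) :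
    ∃ w₁ : ℝ → ℝ, (∀ t, 0 ≤ t → HasDerivWithinAt w (w₁ t) (Ici 0) t) ∧
      (∀ t, 0 ≤ t → HasDerivWithinAt w₁ (g t - w t) (Ici 0) t) ∧ w₁ 0 = 0 ∧ w₁ (2 * π) = 0 := by
  have hud := uniqueDiffOn_Ici (0 : ℝ)
  have h1 : ContDiffOn ℝ 1 (derivWithin w (Ici 0)) (Ici 0) :=
    hw.contDiffOn.derivWithin hud (by norm_num)
  have h2 : ContinuousOn (derivWithin (derivWithin w (Ici 0)) (Ici 0)) (Ici 0) :=
    (h1.derivWithin (m := 0) hud (by norm_num)).continuousOn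
  have hint : ∀ t, 0 < t → derivWithin (derivWithin w (Ici 0)) (Ici 0) t = g t - w t := by
    intro t ht
    have e : derivWithin w (Ici 0) =ᶠ[nhds t] deriv w := by
      filter_upwards [Ioi_mem_nhds ht] with s hs
      exact derivWithin_of_mem_nhds (Ici_mem_nhds hs)
    rw [derivWithin_of_mem_nhds (Ici_mem_nhds ht), e.deriv_eq]
    linarith [hw.eqn t ht]
  have heq : EqOn (derivWithin (derivWithin w (Ici 0)) (Ici 0)) (fun t => g t - w t) (Ici 0) :=
    EqOn.of_subset_closure (s := Ioi 0) (fun t ht => hint t ht) h2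
      (hg.continuousOn.sub hw.contDiffOn.continuousOn) Ioi_subset_Ici_self
      (by rw [closure_Ioi])
  refine ⟨derivWithin w (Ici 0), fun t ht => ?_, fun t ht => ?_, hw.deriv_left, hw.deriv_right⟩
  · exact (hw.contDiffOn.differentiableOn (by norm_num) t ht).hasDerivWithinAt
  · exact (h1.differentiableOn one_ne_zero t ht).hasDerivWithinAt.congr_deriv (heq ht)

theorem IsODESolution.eqOn {g v w : ℝ → ℝ} (hg : Continuous g) (hv : IsODESolution g v)
    (hw : IsODESolution g w) : EqOn v w (Ici 0) := by
  obtain ⟨v₁, hv1, hv2, hv0, -⟩ := hv.exists_deriv hg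
  obtain ⟨w₁, hw1, hw2, hw0, -⟩ := hw.exists_deriv hg
  intro t ht
  refine sub_eq_zero.1 (eq_zero_of_harmonic_oscillator (z := fun t => v t - w t)
    (z₁ := fun t => v₁ t - w₁ t) (fun s hs => (hv1 s hs).sub (hw1 s hs))
    (fun s hs => ((hv2 s hs).sub (hw2 s hs)).congr_deriv (by ring)) ?_ ?_ ht)
  · simp [hv.zero_left, hw.zero_left]
  · simp [hv0, hw0]

/-- The Cauchy data of `w` at `0` and at `2π` agree, so `w (· + 2π)` and `w` coincide. -/
theorem IsODESolution.periodic {g w : ℝ → ℝ} (hg : Continuous g)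
    (hper : Function.Periodic g (2 * π)) (hw : IsODESolution g w) {t : ℝ} (ht : 0 ≤ t) :
    w (t + 2 * π) = w t := by
  obtain ⟨w₁, hw1, hw2, hw0, hw2π⟩ := hw.exists_deriv hg
  have shift : ∀ {f : ℝ → ℝ} {f' s : ℝ}, HasDerivWithinAt f f' (Ici 0) (s + 2 * π) →
      HasDerivWithinAt (fun r => f (r + 2 * π)) f' (Ici 0) s := by
    intro f f' s hf
    have h := ((hasDerivAt_id s).add_const (2 * π)).hasDerivWithinAt (s := Ici 0)
    have := HasDerivWithinAt.comp (h := fun r => r + 2 * π) s hf h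
      fun r (hr : 0 ≤ r) => show 0 ≤ r + 2 * π by positivity
    simpa [Function.comp_def] using this
  refine sub_eq_zero.1 (eq_zero_of_harmonic_oscillator (z := fun t => w (t + 2 * π) - w t)
    (z₁ := fun t => w₁ (t + 2 * π) - w₁ t)
    (fun s hs => (shift (hw1 (s + 2 * π) (by positivity))).sub (hw1 s hs))
    (fun s hs => ((shift (hw2 (s + 2 * π) (by positivity))).sub (hw2 s hs)).congr_deriv
      (by rw [hper]; ring)) ?_ ?_ ht)
  · simp [hw.zero_left, hw.zero_right]
  · simp [hw0, hw2π]

/-- The equation determines the Fourier coefficients of `w`, except those of order one. -/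
theorem IsODESolution.fourierCoeffs {g w : ℝ → ℝ} (hg : Continuous g) (hw : IsODESolution g w)
    (m : ℕ) : cosCoeff g m = (1 - (m : ℝ) ^ 2) * cosCoeff w m ∧
      sinCoeff g m = (1 - (m : ℝ) ^ 2) * sinCoeff w m := by
  obtain ⟨w₁, hw1, hw2, hw0, hw2π⟩ := hw.exists_deriv hg
  have hwc : ContinuousOn w (uIcc 0 (2 * π)) := by
    rw [uIcc_of_le two_pi_pos.le]
    exact hw.contDiffOn.continuousOn.mono fun t ht => ht.1
  have key : ∀ φ φ₁ : ℝ → ℝ, (∀ t, HasDerivAt φ (φ₁ t) t) →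
      (∀ t, HasDerivAt φ₁ (-(m : ℝ) ^ 2 * φ t) t) → (1 / π * ∫ t in 0..2 * π, g t * φ t) =
      (1 - (m : ℝ) ^ 2) * (1 / π * ∫ t in 0..2 * π, w t * φ t) := by
    intro φ φ₁ hφ hφ₁
    have hφc : Continuous φ := continuous_iff_continuousAt.2 fun t => (hφ t).continuousAt
    have h := integral_mul_deriv_deriv le_rfl two_pi_pos.le hw1 hw2
      (hg.continuousOn.sub hw.contDiffOn.continuousOn) hφ hφ₁
    have i1 : IntervalIntegrable (fun t => g t * φ t) MeasureTheory.volume 0 (2 * π) :=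
      (hg.mul hφc).intervalIntegrable _ _
    have i2 : IntervalIntegrable (fun t => w t * φ t) MeasureTheory.volume 0 (2 * π) :=
      (hwc.mul hφc.continuousOn).intervalIntegrable
    simp only [mul_comm (φ _), sub_mul] at h
    rw [intervalIntegral.integral_sub i1 i2, hw.zero_left, hw.zero_right, hw0, hw2π] at h
    have h' : (∫ t in 0..2 * π, g t * φ t) = (1 - (m : ℝ) ^ 2) * ∫ t in 0..2 * π, w t * φ t := by
      linarith
    rw [h']
    ring
  exact ⟨key _ _ (hasDerivAt_cos_mul m)
      fun t => ((hasDerivAt_sin_mul m t).const_mul (-m : ℝ)).congr_deriv (by ring),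
    key _ _ (hasDerivAt_sin_mul m)
      fun t => ((hasDerivAt_cos_mul m t).const_mul (m : ℝ)).congr_deriv (by ring)⟩

/-- By Cauchy–Schwarz, in the form `2 |a b| ≤ a² + b²`, for a square-summable `x` and weights `y`
with the decay of all those in the Fourier expansion of the profile. -/
theorem summable_mul_of_summable_sq {x y : ℕ → ℝ} (hx : Summable fun k => x k ^ 2)
    (hy : ∀ k : ℕ, |y k| ≤ 1 / ((k : ℝ) + 1)) : Summable fun k => y k * x (k + 2) := by
  have h1 : Summable fun k : ℕ => (1 / ((k : ℝ) + 1)) ^ 2 := by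
    have := (summable_nat_add_iff 1).2 (Real.summable_one_div_nat_pow.2 one_lt_two)
    simpa [div_pow] using this
  refine Summable.of_norm_bounded (h1.add ((summable_nat_add_iff 2).2 hx)) fun k => ?_
  rw [norm_mul, Real.norm_eq_abs, Real.norm_eq_abs]
  have h2 := hy k
  rw [← sq_abs (x (k + 2))]
  have h3 : |y k| ^ 2 ≤ (1 / ((k : ℝ) + 1)) ^ 2 := pow_le_pow_left₀ (abs_nonneg _) h2 2
  nlinarith [sq_nonneg (|y k| - |x (k + 2)|), sq_nonneg (|x (k + 2)|), sq_nonneg (|y k|)]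

theorem abs_freq_div_le (k : ℕ) :
    |((k : ℝ) + 2) / (((k : ℝ) + 2) ^ 2 - 1)| ≤ 1 / ((k : ℝ) + 1) := by
  have hk : (0 : ℝ) ≤ k := k.cast_nonneg
  have h : (0 : ℝ) < ((k : ℝ) + 2) ^ 2 - 1 := by nlinarith
  rw [abs_of_nonneg (by positivity), div_le_div_iff₀ h (by positivity)]
  nlinarith

theorem abs_mul_div_le (k : ℕ) {s : ℝ} (hs : |s| ≤ 1) :
    |s / (((k : ℝ) + 2) ^ 2 - 1)| ≤ 1 / ((k : ℝ) + 1) := by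
  have hk : (0 : ℝ) ≤ k := k.cast_nonneg
  have h : (0 : ℝ) < ((k : ℝ) + 2) ^ 2 - 1 := by nlinarith
  rw [abs_div, abs_of_pos h, div_le_div_iff₀ h (by positivity)]
  nlinarith

/-! ### Fourier expansion of the profile -/

theorem IsODESolution.hasFourierExpansion {g w : ℝ → ℝ} (hg : Continuous g)
    (hper : Function.Periodic g (2 * π)) (hw : IsODESolution g w) :
    Summable (fun k : ℕ => cosCoeff g (k + 2) / (((k : ℝ) + 2) ^ 2 - 1)) ∧
    Summable (fun k : ℕ => ((k : ℝ) + 2) / (((k : ℝ) + 2) ^ 2 - 1) * sinCoeff g (k + 2)) ∧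
    (∀ t : ℝ, Summable (fun k : ℕ =>
      cosCoeff g (k + 2) / (((k : ℝ) + 2) ^ 2 - 1) * cos (((k : ℝ) + 2) * t) +
        sinCoeff g (k + 2) / (((k : ℝ) + 2) ^ 2 - 1) * sin (((k : ℝ) + 2) * t))) ∧
    (∀ t : ℝ, 0 ≤ t → w t =
      cosCoeff g 0 / 2 +
      (-(cosCoeff g 0 / 2) +
        ∑' k : ℕ, cosCoeff g (k + 2) / (((k : ℝ) + 2) ^ 2 - 1)) * cos t +
      (∑' k : ℕ, ((k : ℝ) + 2) / (((k : ℝ) + 2) ^ 2 - 1) * sinCoeff g (k + 2)) * sin t -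
      ∑' k : ℕ, (cosCoeff g (k + 2) / (((k : ℝ) + 2) ^ 2 - 1) * cos (((k : ℝ) + 2) * t) +
        sinCoeff g (k + 2) / (((k : ℝ) + 2) ^ 2 - 1) * sin (((k : ℝ) + 2) * t))) := by
  have hc2 := summable_sq_cosCoeff hg
  have hd2 := summable_sq_sinCoeff hg
  have hk : ∀ k : ℕ, (((k : ℝ) + 2) ^ 2 - 1) ≠ 0 := fun k => by
    have : (0 : ℝ) ≤ k := k.cast_nonneg
    nlinarith
  have hsC : ∀ s : ℕ → ℝ, (∀ k, |s k| ≤ 1) → Summable fun k : ℕ =>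
      cosCoeff g (k + 2) / (((k : ℝ) + 2) ^ 2 - 1) * s k := fun s hs =>
    (summable_mul_of_summable_sq hc2 fun k => abs_mul_div_le k (hs k)).congr fun k => by ring
  have hsS : ∀ s : ℕ → ℝ, (∀ k, |s k| ≤ 1) → Summable fun k : ℕ =>
      sinCoeff g (k + 2) / (((k : ℝ) + 2) ^ 2 - 1) * s k := fun s hs =>
    (summable_mul_of_summable_sq hd2 fun k => abs_mul_div_le k (hs k)).congr fun k => by ring
  have hsC1 : Summable fun k : ℕ => cosCoeff g (k + 2) / (((k : ℝ) + 2) ^ 2 - 1) := by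
    simpa using hsC (fun _ => 1) fun _ => by simp
  have hsS1 : Summable fun k : ℕ => sinCoeff g (k + 2) / (((k : ℝ) + 2) ^ 2 - 1) := by
    simpa using hsS (fun _ => 1) fun _ => by simp
  have hfC : Summable fun k : ℕ =>
      ((k : ℝ) + 2) / (((k : ℝ) + 2) ^ 2 - 1) * cosCoeff g (k + 2) :=
    summable_mul_of_summable_sq hc2 abs_freq_div_le
  have hfS : Summable fun k : ℕ =>
      ((k : ℝ) + 2) / (((k : ℝ) + 2) ^ 2 - 1) * sinCoeff g (k + 2) :=
    summable_mul_of_summable_sq hd2 abs_freq_div_le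
  set G : ℕ → ℝ → ℝ := fun k t =>
    cosCoeff g (k + 2) / (((k : ℝ) + 2) ^ 2 - 1) * cos (((k : ℝ) + 2) * t) +
      sinCoeff g (k + 2) / (((k : ℝ) + 2) ^ 2 - 1) * sin (((k : ℝ) + 2) * t) with hG
  have hGs : ∀ t, Summable fun k => G k t := fun t =>
    (hsC _ fun k => abs_cos_le_one _).add (hsS _ fun k => abs_sin_le_one _)
  -- the Fourier coefficients of `w`
  have hcw : ∀ k : ℕ, cosCoeff w (k + 2) = -(cosCoeff g (k + 2) / (((k : ℝ) + 2) ^ 2 - 1)) := by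
    intro k
    have h1 := hk k
    rw [(hw.fourierCoeffs hg (k + 2)).1]
    push_cast
    field_simp
    ring
  have hdw : ∀ k : ℕ, sinCoeff w (k + 2) = -(sinCoeff g (k + 2) / (((k : ℝ) + 2) ^ 2 - 1)) := by
    intro k
    have h1 := hk k
    rw [(hw.fourierCoeffs hg (k + 2)).2]
    push_cast
    field_simp
    ring
  have hc0 : cosCoeff w 0 = cosCoeff g 0 := by
    rw [(hw.fourierCoeffs hg 0).1]; simp
  set α := cosCoeff w 1
  set β := sinCoeff w 1
  have hwc : ContinuousOn w (Icc 0 (0 + 2 * π)) :=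
    hw.contDiffOn.continuousOn.mono fun t ht => ht.1
  have hCint : ∀ m : ℕ, ∫ s in 0..0 + 2 * π, w s * cos (m * s) = π * cosCoeff w m := fun m => by
    rw [zero_add, cosCoeff, ← mul_assoc, mul_one_div_cancel pi_ne_zero, one_mul]
  have hSint : ∀ m : ℕ, ∫ s in 0..0 + 2 * π, w s * sin (m * s) = π * sinCoeff w m := fun m => by
    rw [zero_add, sinCoeff, ← mul_assoc, mul_one_div_cancel pi_ne_zero, one_mul]
  have hsum : ∀ t ∈ Icc 0 (2 * π), w t =
      cosCoeff g 0 / 2 + α * cos t + β * sin t - ∑' k, G k t := by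
    intro t ht
    have h := hasSum_fourier_real hwc (by rw [zero_add, hw.zero_left, hw.zero_right])
      (by
        simp only [hCint]
        refine Summable.mul_left _ ((summable_nat_add_iff 2).1 ?_)
        simp only [hcw]
        exact hsC1.neg)
      (by
        simp only [hSint]
        refine Summable.mul_left _ ((summable_nat_add_iff 2).1 ?_)
        simp only [hdw]
        exact hsS1.neg) (t := t) (by rwa [zero_add])
    have h0 : ∫ s in 0..0 + 2 * π, w s = π * cosCoeff g 0 := by
      rw [← hc0, ← hCint]; simp
    simp only [hCint, hSint, h0] at h
    -- split off the frequencies zero and one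
    rw [← hasSum_nat_add_iff' 2] at h
    have h1 : HasSum (fun k => -G k t) _ := (hGs t).hasSum.neg
    have h2 := h.unique (h1.congr_fun fun k => by
      rw [hcw, hdw]
      simp only [hG]
      push_cast
      field_simp
      ring)
    simp only [Finset.sum_range_succ, Finset.sum_range_zero, hc0] at h2
    simp only [Nat.cast_zero, Nat.cast_one, zero_mul, one_mul, cos_zero, sin_zero] at h2
    have h3 : 1 / (2 * π) * (π * cosCoeff g 0) = cosCoeff g 0 / 2 := by
      field_simp
    rw [h3] at h2
    have h5 : 1 / π * (π * cosCoeff g 0 * 1 + π * sinCoeff w 0 * 0) = cosCoeff g 0 := by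
      field_simp
      ring
    have h6 : 1 / π * (π * cosCoeff w 1 * cos t + π * sinCoeff w 1 * sin t) =
        α * cos t + β * sin t := by
      change 1 / π * (π * α * cos t + π * β * sin t) = _
      field_simp
    linarith
  -- the condition `w 0 = 0` determines the cosine coefficient of order one
  have hα : α = -(cosCoeff g 0 / 2) +
      ∑' k : ℕ, cosCoeff g (k + 2) / (((k : ℝ) + 2) ^ 2 - 1) := by
    have h := hsum 0 ⟨le_rfl, two_pi_pos.le⟩
    simp only [hG, hw.zero_left, mul_zero, cos_zero, sin_zero, mul_one, add_zero] at h
    linarith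
  -- the condition `w' 0 = 0` determines the sine coefficient of order one
  have hβ : β = ∑' k : ℕ, ((k : ℝ) + 2) / (((k : ℝ) + 2) ^ 2 - 1) * sinCoeff g (k + 2) := by
    obtain ⟨w₁, hw1, -, hw0, -⟩ := hw.exists_deriv hg
    have hGd : ∀ k t, HasDerivAt (G k) (cosCoeff g (k + 2) / (((k : ℝ) + 2) ^ 2 - 1) *
        (-((k : ℝ) + 2) * sin (((k : ℝ) + 2) * t)) + sinCoeff g (k + 2) /
        (((k : ℝ) + 2) ^ 2 - 1) * (((k : ℝ) + 2) * cos (((k : ℝ) + 2) * t))) t := fun k t =>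
      ((hasDerivAt_cos_mul _ t).const_mul _).add ((hasDerivAt_sin_mul _ t).const_mul _)
    have htsum := hasDerivAt_tsum (hfC.norm.add hfS.norm) hGd (fun k t => by
      refine (norm_add_le _ _).trans (add_le_add ?_ ?_)
      · rw [show cosCoeff g (k + 2) / (((k : ℝ) + 2) ^ 2 - 1) *
          (-((k : ℝ) + 2) * sin (((k : ℝ) + 2) * t)) = (((k : ℝ) + 2) / (((k : ℝ) + 2) ^ 2 - 1) *
          cosCoeff g (k + 2)) * -sin (((k : ℝ) + 2) * t) by ring, norm_mul _ (-sin _), norm_neg]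
        exact mul_le_of_le_one_right (norm_nonneg _) (abs_sin_le_one _)
      · rw [show sinCoeff g (k + 2) / (((k : ℝ) + 2) ^ 2 - 1) *
          (((k : ℝ) + 2) * cos (((k : ℝ) + 2) * t)) = (((k : ℝ) + 2) / (((k : ℝ) + 2) ^ 2 - 1) *
          sinCoeff g (k + 2)) * cos (((k : ℝ) + 2) * t) by ring, norm_mul _ (cos _)]
        exact mul_le_of_le_one_right (norm_nonneg _) (abs_cos_le_one _)) (hGs 0) 0
    have hd1 : HasDerivWithinAt w _ (Icc 0 (2 * π)) 0 :=
      ((((hasDerivAt_const (0 : ℝ) (cosCoeff g 0 / 2)).add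
        ((hasDerivAt_cos 0).const_mul α)).add ((hasDerivAt_sin 0).const_mul β)).sub
        htsum).hasDerivWithinAt.congr (fun t ht => hsum t ht) (hsum 0 ⟨le_rfl, two_pi_pos.le⟩)
    have hd2 : HasDerivWithinAt w 0 (Icc 0 (2 * π)) 0 :=
      ((hw1 0 le_rfl).mono fun t (ht : t ∈ Icc 0 (2 * π)) => ht.1).congr_deriv hw0
    have h := (uniqueDiffOn_Icc two_pi_pos 0 ⟨le_rfl, two_pi_pos.le⟩).eq_deriv _ hd1 hd2
    simp only [mul_zero, cos_zero, sin_zero, neg_zero, mul_one, zero_add, add_zero] at h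
    rw [sub_eq_zero] at h
    rw [h]
    exact tsum_congr fun k => by ring
  refine ⟨hsC1, hfS, hGs, fun t ht => ?_⟩
  rw [← hα, ← hβ]
  -- both sides are `2π`-periodic, so it suffices to treat `[0, 2π]`
  have hGper : ∀ (k : ℕ), Function.Periodic (G k) (2 * π) := fun k s => by
    have e : ((k : ℝ) + 2) * (s + 2 * π) = ((k : ℝ) + 2) * s + ((k + 2 : ℕ) : ℝ) * (2 * π) := by
      push_cast; ring
    simp only [hG, e, cos_add_nat_mul_two_pi, sin_add_nat_mul_two_pi]
  have hRper : Function.Periodic (fun s => cosCoeff g 0 / 2 + α * cos s + β * sin s -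
      ∑' k, G k s) (2 * π) := fun s => by
    simp only [cos_add_two_pi, sin_add_two_pi, hGper _ s]
  have hwper : ∀ (j : ℕ) (s : ℝ), 0 ≤ s → w (s + j * (2 * π)) = w s := by
    intro j s hs
    induction j with
    | zero => simp
    | succ j ih =>
      rw [← ih, ← hw.periodic hg hper (t := s + j * (2 * π)) (by positivity)]
      push_cast
      ring_nf
  have hfl := Nat.floor_le (div_nonneg ht two_pi_pos.le)
  have hfl' := Nat.lt_floor_add_one (t / (2 * π))
  rw [le_div_iff₀ two_pi_pos] at hfl
  rw [div_lt_iff₀ two_pi_pos] at hfl'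
  obtain ⟨s, hs⟩ : ∃ s, s = t - ⌊t / (2 * π)⌋₊ * (2 * π) := ⟨_, rfl⟩
  have hts : t = s + ⌊t / (2 * π)⌋₊ * (2 * π) := by rw [hs]; ring
  have hs0 : 0 ≤ s := by linarith
  have h1 := hsum s ⟨hs0, by linarith⟩
  have h2 := hRper.nat_mul ⌊t / (2 * π)⌋₊ s
  rw [← hts] at h2
  have h3 := hwper ⌊t / (2 * π)⌋₊ s hs0
  rw [← hts] at h3
  exact h3.trans (h1.trans h2.symm)

theorem derivAlong_tangential_eq_zero {n : ℕ} {f : Pt n → ℝ}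
    (hf : ContDiffOn ℝ 1 f (closedHalfSpace n)) {t : ℝ} (ht : 0 ≤ t)
    (h : ∀ x y, f (x, t) = f (y, t)) (x e : EuclideanSpace ℝ (Fin n)) :
    derivAlong (e, 0) f (x, t) = 0 := by
  have h1 := hasFDerivAt_slice hf x ht
  have h2 : (fun y => f (y, t)) = fun _ => f (x, t) := funext fun y => h y x
  rw [h2] at h1
  have h3 := h1.unique (hasFDerivAt_const _ _)
  have h4 := congrArg (fun L => L e) h3
  simpa [tangentialFDeriv, derivAlong] using h4

/-- Solutions of the problem in the half space are one-dimensional, and their profiles solve the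
one-dimensional problem. -/
theorem isODESolution_of_isClassicalSolution {n : ℕ} (hn : n ≤ 2)
    {B : EuclideanSpace ℝ (Fin n) → Matrix (Fin n) (Fin n) ℝ} (hB : AdmissibleCoeff B)
    {g : ℝ → ℝ} (hg : Continuous g) (hper : Function.Periodic g (2 * π))
    (hc : 0 ≤ cosCoeff g 1) (hd : 0 ≤ sinCoeff g 1)
    {u : Pt n → ℝ} (hu : IsClassicalSolution (blockMatrix B) g u) (hub : NonnegBoundedOnStrips u) :
    (∀ x t, 0 ≤ t → u (x, t) = u (0, t)) ∧ IsODESolution g fun t => u (0, t) := by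
  have hstrip := strip_symmetry hn hB hg hper hc hd hu hub
  have hzero : ∀ (j : ℕ) x, u (x, j * (2 * π)) = 0 := by
    intro j
    induction j with
    | zero => intro x; simpa using hu.boundary x
    | succ j ih =>
      intro x
      have := (hstrip j ih).2.2.1 x
      rwa [show (j : ℝ) * (2 * π) + 2 * π = ((j + 1 : ℕ) : ℝ) * (2 * π) by push_cast; ring] at this
  have hsymm : ∀ t, 0 ≤ t → ∀ x y, u (x, t) = u (y, t) := by
    intro t ht x y
    have hfl := Nat.floor_le (div_nonneg ht two_pi_pos.le)
    have hfl' := Nat.lt_floor_add_one (t / (2 * π))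
    rw [le_div_iff₀ two_pi_pos] at hfl
    rw [div_lt_iff₀ two_pi_pos] at hfl'
    exact (hstrip _ (hzero _)).2.2.2 x y t ⟨hfl, by linarith⟩
  refine ⟨fun x t ht => hsymm t ht x 0, ?_⟩
  have hu1 : ContDiffOn ℝ 1 u (closedHalfSpace n) := hu.contDiffOn.of_le (by norm_num)
  have hD : ∀ e, ContDiffOn ℝ 1 (derivAlong e u) (closedHalfSpace n) := fun e =>
    hu.contDiffOn.derivAlong (by norm_num) e
  have hud := uniqueDiffOn_Ici (0 : ℝ)
  have hd1 : ∀ t, 0 ≤ t → derivWithin (fun t => u (0, t)) (Ici 0) t = derivAlong (0, 1) u (0, t) :=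
    fun t ht => (hasDerivWithinAt_slice hu1 0 ht).derivWithin (hud t ht)
  refine ⟨hu.contDiffOn.comp (by fun_prop) fun t ht => ht, fun t ht => ?_, hu.boundary 0,
    ?_, ?_, ?_⟩
  · have h1 := hu.eqn (0, t) ht
    rw [divGrad_blockMatrix hB hu.contDiffOn 0 ht] at h1
    have h2 : ∀ (e : EuclideanSpace ℝ (Fin n)) s, 0 ≤ s → ∀ x, derivAlong (e, 0) u (x, s) = 0 :=
      fun e s hs x => derivAlong_tangential_eq_zero hu1 hs (hsymm s hs) x e
    have h3 : ∀ e f : EuclideanSpace ℝ (Fin n),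
        derivAlong (f, 0) (derivAlong (e, 0) u) (0, t) = 0 := fun e f =>
      derivAlong_tangential_eq_zero (hD _) ht.le (fun x y => by rw [h2 e t ht.le, h2 e t ht.le]) 0 f
    simp only [h2 _ t ht.le, h3, mul_zero, add_zero, Finset.sum_const_zero, zero_add] at h1
    have h4 : deriv (fun t => u (0, t)) =ᶠ[nhds t] fun s => derivAlong (0, 1) u (0, s) := by
      filter_upwards [Ioi_mem_nhds ht] with s hs
      rw [← hd1 s (le_of_lt hs), derivWithin_of_mem_nhds (Ici_mem_nhds hs)]
    rw [h4.deriv_eq, ((hasDerivWithinAt_slice (hD (0, 1)) 0 ht.le).hasDerivAt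
      (Ici_mem_nhds ht)).deriv]
    exact h1
  · simpa using hzero 1 0
  · rw [hd1 0 le_rfl]
    simpa using (hstrip 0 (hzero 0)).2.1 0
  · rw [hd1 _ two_pi_pos.le]
    simpa using (hstrip 1 (hzero 1)).2.1 0

theorem mainTheorem6 (N : ℕ) (hN : N = 2 ∨ N = 3)
    (Ahat : EuclideanSpace ℝ (Fin (N - 1)) → Matrix (Fin (N - 1)) (Fin (N - 1)) ℝ)
    (hA : AdmissibleCoeff Ahat)
    (g : ℝ → ℝ) (hg : Continuous g) (hper : Function.Periodic g (2 * π))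
    (hc : 0 ≤ cosCoeff g 1) (hd : 0 ≤ sinCoeff g 1)
    (u : Pt (N - 1) → ℝ) (hu : IsClassicalSolution (blockMatrix Ahat) g u)
    (hub : NonnegBoundedOnStrips u) :
    cosCoeff g 1 = 0 ∧ sinCoeff g 1 = 0 ∧
    (∃ w : ℝ → ℝ,
      -- `u` is one-dimensional with profile `w`, and `2π`-periodic
      (∀ (x' : EuclideanSpace ℝ (Fin (N - 1))) (t : ℝ), 0 ≤ t → u (x', t) = w t) ∧
      (∀ t : ℝ, 0 ≤ t → w (t + 2 * π) = w t) ∧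
      -- `w` is the unique solution of the one-dimensional problem
      IsODESolution g w ∧
      (∀ v : ℝ → ℝ, IsODESolution g v → EqOn v w (Ici 0)) ∧
      -- the expression in Fourier series (with `m = k + 2`), all series being convergent
      Summable (fun k : ℕ => cosCoeff g (k + 2) / (((k : ℝ) + 2) ^ 2 - 1)) ∧
      Summable (fun k : ℕ => ((k : ℝ) + 2) / (((k : ℝ) + 2) ^ 2 - 1) * sinCoeff g (k + 2)) ∧
      (∀ t : ℝ, Summable (fun k : ℕ =>
        cosCoeff g (k + 2) / (((k : ℝ) + 2) ^ 2 - 1) * cos (((k : ℝ) + 2) * t) +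
          sinCoeff g (k + 2) / (((k : ℝ) + 2) ^ 2 - 1) * sin (((k : ℝ) + 2) * t))) ∧
      (∀ t : ℝ, 0 ≤ t → w t =
        cosCoeff g 0 / 2 +
        (-(cosCoeff g 0 / 2) +
          ∑' k : ℕ, cosCoeff g (k + 2) / (((k : ℝ) + 2) ^ 2 - 1)) * cos t +
        (∑' k : ℕ, ((k : ℝ) + 2) / (((k : ℝ) + 2) ^ 2 - 1) * sinCoeff g (k + 2)) * sin t -
        ∑' k : ℕ, (cosCoeff g (k + 2) / (((k : ℝ) + 2) ^ 2 - 1) * cos (((k : ℝ) + 2) * t) +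
          sinCoeff g (k + 2) / (((k : ℝ) + 2) ^ 2 - 1) * sin (((k : ℝ) + 2) * t)))) ∧
    -- `u` is the only solution of the problem in its class
    (∀ v : Pt (N - 1) → ℝ, IsClassicalSolution (blockMatrix Ahat) g v →
      NonnegBoundedOnStrips v → EqOn v u (closedHalfSpace (N - 1))) := by
  have hn : N - 1 ≤ 2 := by omega
  obtain ⟨⟨hc1, hd1⟩, -⟩ := strip_symmetry hn hA hg hper hc hd hu hub 0
    fun x => by simpa using hu.boundary x
  obtain ⟨hsymm, hw⟩ := isODESolution_of_isClassicalSolution hn hA hg hper hc hd hu hub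
  refine ⟨hc1, hd1, ⟨fun t => u (0, t), fun x t ht => hsymm x t ht,
    fun t ht => hw.periodic hg hper ht, hw, fun v hv => hv.eqOn hg hw,
      hw.hasFourierExpansion hg hper⟩, fun v hv hvb => ?_⟩
  obtain ⟨hsymm', hw'⟩ := isODESolution_of_isClassicalSolution hn hA hg hper hc hd hv hvb
  rintro ⟨x, t⟩ (ht : 0 ≤ t)
  rw [hsymm x t ht, hsymm' x t ht]
  exact hw'.eqOn hg hw ht
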